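/- Let $k:(0,\infty)\to[0,\infty)$ be a locally integrable function whose Laplace transform $\mathcal K(p)=\int_0^\infty e^{-pt}k(t)\,dt$ exists (is finite) for every $p>0$, and put $\Phi(p)=p\,\mathcal K(p)$. Assume: (*) $\mathcal K$ is a Stieltjes function, that is, $\mathcal K(p)=\frac ap+b+\int_{[0,\infty)}\frac{\sigma(dt)}{p+t}$ for $p>0$, with constants $a,b\ge 0$ and a Borel measure $\sigma$ on $[0,\infty)$ such that $\int_{[0,\infty)}\frac{\sigma(dt)}{1+t}<\infty$; moreover $\mathcal K(p)\to\infty$ and $p\mathcal K(p)\to0$ as $p\to0+$, and $\mathcal K(p)\to0$ and $p\mathcal K(p)\to\infty$ as $p\to\infty$. Assume also that $\int_1^\infty\frac{ds}{s\,\Phi(s)}<\infty$. Let $\lambda>0$. Then there is a unique $p_0=p_0(\lambda)>0$ with $\Phi(p_0)=\lambda$; $\Phi$ is differentiable at $p_0$ and $\Phi'(p_0)>0$. The Cauchy problem $$(\mathbb D_{(k)}u)(t):=\frac{d}{dt}\int_0^t k(t-\tau)u(\tau)\,d\tau-k(t)u(0)=\lambda u(t)\quad\text{for almost every } t>0,\qquad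 u(0)=1,$$ has exactly one solution $u=u_\lambda:[0,\infty)\to\mathbb R$ that is absolutely continuous on every interval $[0,T]$, $T>0$ (the derivative being required to exist for almost every $t>0$), and $$u_\lambda(t)=\frac{\lambda}{\Phi'(p_0)\,p_0}\,e^{p_0t}+o\!\left(e^{p_0t}\right),\qquad t\to\infty .$$ -/

import Mathlib

open MeasureTheory Set Filter Topology Asymptotics

noncomputable section

/-- The Laplace transform `𝒦(p) = ∫₀^∞ e^{-pt} k(t) dt` on the real axis. -/
def laplaceTransform (k : ℝ → ℝ) (p : ℝ) : ℝ :=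
  ∫ t in Ioi (0 : ℝ), Real.exp (-(p * t)) * k t

/-- `Φ(p) = p 𝒦(p)`. -/
def laplaceExponent (k : ℝ → ℝ) (p : ℝ) : ℝ :=
  p * laplaceTransform k p

/-- Stieltjes functions on `(0, ∞)`: `ψ(p) = a / p + b + ∫_{[0,∞)} σ(dt) / (p + t)` with
`a, b ≥ 0` and `σ` a Borel measure on `[0, ∞)` with `∫_{[0,∞)} σ(dt) / (1 + t) < ∞`. -/
def IsStieltjes (ψ : ℝ → ℝ) : Prop :=
  ∃ (a b : ℝ) (σ : Measure ℝ), 0 ≤ a ∧ 0 ≤ b ∧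
    IntegrableOn (fun t : ℝ => (1 + t)⁻¹) (Ici 0) σ ∧
    ∀ p : ℝ, 0 < p → ψ p = a / p + b + ∫ t in Ici (0 : ℝ), (p + t)⁻¹ ∂σ

/-- The standing assumption (∗) on the kernel `k` (only its values on `(0, ∞)` matter).
Integrability of `e^{-pt} k(t)` on `(0, ∞)` contains local integrability of `k` on `[0, ∞)`. -/
structure IsAdmissibleKernel (k : ℝ → ℝ) : Prop where
  nonneg : ∀ t : ℝ, 0 < t → 0 ≤ k t
  integrable : ∀ p : ℝ, 0 < p →
    IntegrableOn (fun t : ℝ => Real.exp (-(p * t)) * k t) (Ioi 0)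
  stieltjes : IsStieltjes (laplaceTransform k)
  tendsto_zero : Tendsto (laplaceTransform k) (𝓝[>] 0) atTop
  tendsto_top : Tendsto (laplaceTransform k) atTop (𝓝 0)
  mul_tendsto_zero : Tendsto (fun p : ℝ => p * laplaceTransform k p) (𝓝[>] 0) (𝓝 0)
  mul_tendsto_top : Tendsto (fun p : ℝ => p * laplaceTransform k p) atTop atTop

/-- The convolution `t ↦ ∫₀^t k(t - τ) u(τ) dτ`. -/
def kernelConv (k u : ℝ → ℝ) (t : ℝ) : ℝ :=
  ∫ τ in (0 : ℝ)..t, k (t - τ) * u τ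

/-- The general fractional derivative
`(𝔻_(k) u)(t) = d/dt ∫₀^t k(t - τ) u(τ) dτ - k(t) u(0)`. -/
def genFracDeriv (k u : ℝ → ℝ) (t : ℝ) : ℝ :=
  deriv (kernelConv k u) t - k t * u 0

/-- `u` is an absolutely continuous solution of `𝔻_(k) u = lam u` on `(0, ∞)`, `u(0) = 1`:
`u` is absolutely continuous on every `[0, T]`, and for almost every `t > 0` the derivative
defining `(𝔻_(k) u)(t)` exists and the equation holds at `t`. -/
structure IsGrowthSolution (k : ℝ → ℝ) (lam : ℝ) (u : ℝ → ℝ) : Prop where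
  absCont : ∀ T : ℝ, 0 < T → AbsolutelyContinuousOnInterval u 0 T
  initial : u 0 = 1
  equation : ∀ᵐ t ∂(volume.restrict (Ioi (0 : ℝ))),
    DifferentiableAt ℝ (kernelConv k u) t ∧ genFracDeriv k u t = lam * u t

end

/-! Writing `u = 1 + 1 * y` with `y = u'`, the Cauchy problem becomes the Volterra equation `k * y =
lam (1 + 1 * y)` almost everywhere. In Laplace transforms it says `ŷ(p) = lam / (Φ(p) - lam)`, so
everything rests on inverting this function on `p > p₀`.

The crux is that `z ↦ 1 / (Φ(p₀ + z) - lam)` is again a Stieltjes function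
(`IsAdmissibleKernel.exists_resolvent_measure`). The proof stays on the real line. With `q = z - 1`,
the difference `Φ(p₀ + z) - lam` equals `m + q ∫ (1 + q β)⁻¹`, whose reciprocal is read off from the
resolvent of a rank-one perturbation `T` of multiplication by `β`. The vanishing at `z = 0` is
exactly what gives `T ≤ 1`. The spectral theorem yields a measure on `[0, 1]`, and `s ↦ 1/s - 1`
carries it to a measure `τ` on `[0, ∞)`.

Hence `y(t) = lam e^{p₀ t} g(t)`, where `g(t) = ∫ (1 + s) e^{-st} dτ(s)`. As `t → ∞`, `g` tends to
the atom `τ{0}`, which is the limit of `z / (Φ(p₀ + z) - lam)` as `z → 0+`, that is `1 / Φ'(p₀)`.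
Integrating `y` gives the asymptotics.

Uniqueness needs no growth bound, hence no Laplace transform: for two solutions, `y₁ * (k * y₂) = y₂
* (k * y₁)`, and inserting the equations leaves `1 * y₁ = 1 * y₂` (`primitive_eq_of_kernelConv_eq`).
-/

/-! ### Spectral measures of an operator between 0 and 1 -/

section SpectralMeasure

open scoped ComplexInnerProductSpace CompactlySupported

/-- Riesz–Markov applied to the positive functional `g ↦ Re ⟨x, g(T) x⟩` on continuous functions on
`[0, 1]`. Extending `g` by constants outside the interval is harmless, since the spectrum lies
inside. -/
theorem exists_spectralMeasure {H : Type*} [NormedAddCommGroup H] [InnerProductSpace ℂ H]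
    [CompleteSpace H] (T : H →L[ℂ] H) (h0 : 0 ≤ T) (h1 : T ≤ 1) (x : H) :
    ∃ ν : Measure ℝ, IsFiniteMeasure ν ∧ (∀ᵐ s ∂ν, s ∈ Icc (0 : ℝ) 1) ∧
      ∀ f : ℝ → ℝ, ContinuousOn f (Icc 0 1) → ∫ s, f s ∂ν = (inner ℂ x (cfc f T x)).re := by
  have hT : IsSelfAdjoint T := .of_nonneg h0
  have hsp : spectrum ℝ T ⊆ Icc 0 1 := fun s hs =>
    ⟨spectrum_nonneg_of_nonneg h0 hs,
      (le_algebraMap_iff_spectrum_le (r := (1 : ℝ)) (a := T)).1 (by simpa using h1) s hs⟩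
  have hc : ∀ g : C_c(Icc (0 : ℝ) 1, ℝ), Continuous (IccExtend zero_le_one g) := fun g =>
    g.continuous.Icc_extend'
  let Λ₀ : C_c(Icc (0 : ℝ) 1, ℝ) →ₗ[ℝ] ℝ :=
    { toFun := fun g => (inner ℂ x (cfc (IccExtend zero_le_one g) T x)).re
      map_add' := fun g h => by
        have : IccExtend (zero_le_one (α := ℝ)) (g + h : C_c(Icc (0 : ℝ) 1, ℝ)) =
          fun s => IccExtend zero_le_one g s + IccExtend zero_le_one h s := by
          ext s; simp [IccExtend]
        rw [this, cfc_add (a := T) _ _ (hc g).continuousOn (hc h).continuousOn]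
        simp
      map_smul' := fun c g => by
        have : IccExtend (zero_le_one (α := ℝ)) (c • g : C_c(Icc (0 : ℝ) 1, ℝ)) =
          fun s => c • IccExtend zero_le_one g s := by
          ext s; simp [IccExtend]
        rw [this, cfc_smul c _ T (hc g).continuousOn]
        rw [smul_apply, ← Complex.coe_smul, inner_smul_right]
        simp }
  let Λ : C_c(Icc (0 : ℝ) 1, ℝ) →ₚ[ℝ] ℝ := PositiveLinearMap.mk₀ Λ₀ (fun g hg => by
    have : 0 ≤ cfc (IccExtend zero_le_one g) T :=
      cfc_nonneg fun s _ => hg _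
    exact ((ContinuousLinearMap.nonneg_iff_isPositive _).1 this).re_inner_nonneg_right x)
  have : IsFiniteMeasureOnCompacts (RealRMK.rieszMeasure Λ) := inferInstance
  have : IsFiniteMeasure (RealRMK.rieszMeasure Λ) := inferInstance
  refine ⟨(RealRMK.rieszMeasure Λ).map Subtype.val, inferInstance, ?_, fun f hf => ?_⟩
  · refine (ae_map_iff measurable_subtype_coe.aemeasurable measurableSet_Icc).2 ?_
    exact Eventually.of_forall fun s => s.2
  · have hme : MeasurableEmbedding (Subtype.val : Icc (0 : ℝ) 1 → ℝ) :=
      MeasurableEmbedding.subtype_coe measurableSet_Icc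
    rw [hme.integral_map]
    let g : C_c(Icc (0 : ℝ) 1, ℝ) := CompactlySupportedContinuousMap.continuousMapEquiv
      ⟨(Icc (0 : ℝ) 1).domRestrict f, hf.domRestrict⟩
    have h1 := RealRMK.integral_rieszMeasure Λ g
    have h2 : Λ g = (inner ℂ x (cfc (IccExtend zero_le_one g) T x)).re := rfl
    have h3 : cfc (IccExtend zero_le_one g) T = cfc f T := cfc_congr fun s hs => by
      rw [IccExtend_of_mem _ _ (hsp hs)]; rfl
    rw [← h3, ← h2, ← h1]; rfl

/-- The resolvent vector is given through the equation it solves, so an application only has to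
exhibit `y`. The condition `q > -1` keeps `1 + q s` positive on `[0, 1]`. -/
theorem exists_measure_resolvent {H : Type*} [NormedAddCommGroup H] [InnerProductSpace ℂ H]
    [CompleteSpace H] (T : H →L[ℂ] H) (h0 : 0 ≤ T) (h1 : T ≤ 1) (x : H) :
    ∃ ν : Measure ℝ, IsFiniteMeasure ν ∧ (∀ᵐ s ∂ν, s ∈ Icc (0 : ℝ) 1) ∧
      ∀ q : ℝ, -1 < q → ∀ y : H, y + (q : ℂ) • T y = x →
        ∫ s, (1 + q * s)⁻¹ ∂ν = (inner ℂ x y).re := by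
  obtain ⟨ν, hν, hs, h⟩ := exists_spectralMeasure T h0 h1 x
  refine ⟨ν, hν, hs, fun q hq y hy => ?_⟩
  have hpos : ∀ s ∈ Icc (0 : ℝ) 1, 0 < 1 + q * s := fun s hs => by
    rcases le_total 0 q with h | h
    · linarith [mul_nonneg h hs.1]
    · nlinarith [mul_nonneg (neg_nonneg.2 h) (sub_nonneg.2 hs.2)]
  have hsp : spectrum ℝ T ⊆ Icc 0 1 := fun s hs =>
    ⟨spectrum_nonneg_of_nonneg h0 hs,
      (le_algebraMap_iff_spectrum_le (r := (1 : ℝ)) (a := T)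
        (IsSelfAdjoint.of_nonneg h0)).1 (by simpa using h1) s hs⟩
  have hT : IsSelfAdjoint T := .of_nonneg h0
  have hf : ContinuousOn (fun s : ℝ => (1 + q * s)⁻¹) (Icc 0 1) :=
    ContinuousOn.inv₀ (by fun_prop) fun s hs => (hpos s hs).ne'
  rw [h _ hf]
  have hy' : cfc (fun s : ℝ => 1 + q * s) T y = x := by
    rw [cfc_const_add (1 : ℝ) (fun s => q * s) T, cfc_const_mul_id q T, ← hy]
    simp [← Complex.coe_smul]
  have : cfc (fun s : ℝ => (1 + q * s)⁻¹) T (cfc (fun s : ℝ => 1 + q * s) T y) = y := by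
    rw [← mul_apply_eq_comp, ← cfc_mul _ _ T (hf.mono hsp) (by fun_prop)]
    have : cfc (fun s : ℝ => (1 + q * s)⁻¹ * (1 + q * s)) T = cfc (fun _ : ℝ => (1 : ℝ)) T :=
      cfc_congr fun s hs => inv_mul_cancel₀ (hpos s (hsp hs)).ne'
    rw [this, cfc_const_one ℝ T]; rfl
  rw [hy'] at this
  rw [this]

end SpectralMeasure

/-! ### Rank-one perturbation of a multiplication operator -/

section RankOne

open scoped ComplexInnerProductSpace CompactlySupported ENNReal

/-- Cauchy–Schwarz, from integrating the square `w⁻¹ (w ‖f‖ - c)²` with the optimal constant `c`. -/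
theorem sq_integral_norm_le {α : Type*} [MeasurableSpace α] {τ : Measure α} {f : α → ℂ}
    {w : α → ℝ} (hw : ∀ x, 0 < w x) (hf : Integrable (fun x => ‖f x‖) τ)
    (hwf : Integrable (fun x => w x * ‖f x‖ ^ 2) τ) (hwi : Integrable (fun x => (w x)⁻¹) τ)
    (hpos : 0 < ∫ x, (w x)⁻¹ ∂τ) :
    (∫ x, ‖f x‖ ∂τ) ^ 2 / ∫ x, (w x)⁻¹ ∂τ ≤ ∫ x, w x * ‖f x‖ ^ 2 ∂τ := by
  set m := ∫ x, (w x)⁻¹ ∂τ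
  set I := ∫ x, ‖f x‖ ∂τ
  set c := I / m with hc
  have h : 0 ≤ ∫ x, (w x * ‖f x‖ ^ 2 - 2 * c * ‖f x‖ + c ^ 2 * (w x)⁻¹) ∂τ := by
    refine integral_nonneg fun x => ?_
    have : w x * ‖f x‖ ^ 2 - 2 * c * ‖f x‖ + c ^ 2 * (w x)⁻¹
        = (w x)⁻¹ * (w x * ‖f x‖ - c) ^ 2 := by
      have := (hw x).ne'
      field_simp
      ring
    simp only [Pi.zero_apply, this]
    exact mul_nonneg (inv_nonneg.2 (hw x).le) (sq_nonneg _)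
  have hA : Integrable (fun x => w x * ‖f x‖ ^ 2 - 2 * c * ‖f x‖) τ := hwf.sub (hf.const_mul _)
  rw [integral_add hA (hwi.const_mul _), integral_sub hwf (hf.const_mul _),
    integral_const_mul, integral_const_mul] at h
  have : I ^ 2 / m = 2 * c * I - c ^ 2 * m := by
    rw [hc]; field_simp; ring
  rw [this]
  linarith

/-- Sherman–Morrison: on `L²(τ)` take `T = β + m⁻¹ ⟨χ, ·⟩ χ` with `χ = 1`. With `X = ∫ (1 + q β)⁻¹`,
one has `⟨χ, (1 + q T)⁻¹ χ⟩ = m X / (m + q X)`, and the identity is algebra from there; `ν` is the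
spectral measure of `T` at `χ`. -/
theorem exists_measure_rankOne_perturbation {α : Type*} [MeasurableSpace α] (τ : Measure α)
    [IsFiniteMeasure τ] {β : α → ℝ} (hβ : Measurable β) {b : ℝ} (hb : b < 1)
    (h0 : ∀ x, 0 ≤ β x) (h1 : ∀ x, β x ≤ b) {m : ℝ} (hm : 0 < m)
    (hint : ∫ x, (1 - β x)⁻¹ ∂τ = m) :
    ∃ ν : Measure ℝ, IsFiniteMeasure ν ∧ (∀ᵐ s ∂ν, s ∈ Icc (0 : ℝ) 1) ∧
      ∀ q : ℝ, -1 < q →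
        (m + q * ∫ x, (1 + q * β x)⁻¹ ∂τ)⁻¹ = m⁻¹ - q / m ^ 2 * ∫ s, (1 + q * s)⁻¹ ∂ν := by
  have hw : ∀ x, 0 < 1 - β x := fun x => by linarith [h1 x]
  have hbm : ∀ {g : α → ℝ} {c : ℝ}, Measurable g → (∀ x, |g x| ≤ c) → Integrable g τ :=
    fun hg hc => Integrable.of_bound hg.aestronglyMeasurable _ (Eventually.of_forall hc)
  have hwi : Integrable (fun x => (1 - β x)⁻¹) τ := hbm (c := (1 - b)⁻¹) (by fun_prop) fun x => by
    rw [abs_of_pos (inv_pos.2 (hw x))]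
    exact inv_anti₀ (by linarith) (by linarith [h1 x])
  have hβL : MemLp (fun x => (β x : ℂ)) ∞ τ :=
    memLp_top_of_bound (by fun_prop) b (Eventually.of_forall fun x => by
      simpa [abs_of_nonneg (h0 x)] using h1 x)
  let M : Lp ℂ 2 τ →L[ℂ] Lp ℂ 2 τ :=
    (ContinuousLinearMap.mul ℂ ℂ).holderL τ ∞ 2 2 hβL.toLp
  have hM : ∀ f : Lp ℂ 2 τ, M f =ᵐ[τ] fun x => (β x : ℂ) * f x := fun f => by
    have h2 := (ContinuousLinearMap.mul ℂ ℂ).coeFn_holder (r := 2) hβL.toLp f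
    filter_upwards [h2, hβL.coeFn_toLp] with x hx hx'
    rw [show M f x = _ from hx, hx']; simp
  have hχL : ∀ c : ℂ, MemLp (fun _ : α => c) 2 τ := fun c => memLp_const c
  let χ : Lp ℂ 2 τ := (hχL 1).toLp
  have hχ : χ =ᵐ[τ] fun _ => 1 := (hχL 1).coeFn_toLp
  let T : Lp ℂ 2 τ →L[ℂ] Lp ℂ 2 τ := M + ((m⁻¹ : ℝ) : ℂ) • InnerProductSpace.rankOne ℂ χ χ
  have hTapp : ∀ f, T f = M f + ((m⁻¹ : ℝ) : ℂ) • (inner ℂ χ f • χ) := fun f => by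
    simp [T, InnerProductSpace.rankOne_apply]
  have hχf : ∀ f : Lp ℂ 2 τ, inner ℂ χ f = ∫ x, f x ∂τ := fun f => by
    rw [L2.inner_def]
    refine integral_congr_ae ?_
    filter_upwards [hχ] with x hx
    rw [hx]; simp
  have hsq : ∀ f : Lp ℂ 2 τ, Integrable (fun x => ‖f x‖ ^ 2) τ := fun f =>
    (Lp.memLp f).integrable_norm_pow (by norm_num)
  have hβsq : ∀ f : Lp ℂ 2 τ, Integrable (fun x => β x * ‖f x‖ ^ 2) τ := fun f =>
    (hsq f).bdd_mul (c := b) hβ.aestronglyMeasurable (Eventually.of_forall fun x => by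
      simpa [abs_of_nonneg (h0 x)] using h1 x)
  have hTf : ∀ f, inner ℂ (T f) f
      = ((∫ x, β x * ‖f x‖ ^ 2 ∂τ + m⁻¹ * ‖inner ℂ χ f‖ ^ 2 : ℝ) : ℂ) := fun f => by
    rw [hTapp, inner_add_left, inner_smul_left, inner_smul_left]
    have : inner ℂ (M f) f = ((∫ x, β x * ‖f x‖ ^ 2 ∂τ : ℝ) : ℂ) := by
      rw [L2.inner_def, ← integral_complex_ofReal]
      refine integral_congr_ae ?_
      filter_upwards [hM f] with x hx
      rw [hx, RCLike.inner_apply]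
      simp only [map_mul, Complex.conj_ofReal, Complex.ofReal_mul, Complex.ofReal_pow,
        ← Complex.mul_conj']
      ring
    rw [this]
    push_cast
    rw [← Complex.conj_mul', Complex.conj_inv, Complex.conj_ofReal]
  have hff : ∀ f : Lp ℂ 2 τ, inner ℂ f f = ((∫ x, ‖f x‖ ^ 2 ∂τ : ℝ) : ℂ) := fun f => by
    rw [L2.inner_def, ← integral_complex_ofReal]
    refine integral_congr_ae (Eventually.of_forall fun x => ?_)
    simp
  have hT0 : 0 ≤ T := by
    rw [ContinuousLinearMap.nonneg_iff_isPositive, ContinuousLinearMap.isPositive_iff_complex]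
    intro f
    rw [hTf]
    refine ⟨by rw [RCLike.re_to_complex, Complex.ofReal_re], ?_⟩
    simp only [RCLike.re_to_complex, Complex.ofReal_re]
    exact add_nonneg (integral_nonneg fun x => mul_nonneg (h0 x) (sq_nonneg _)) (by positivity)
  have hT1 : T ≤ 1 := by
    rw [← sub_nonneg, ContinuousLinearMap.nonneg_iff_isPositive,
      ContinuousLinearMap.isPositive_iff_complex]
    intro f
    rw [sub_apply, inner_sub_left, hTf, one_apply_eq_self, hff, ← Complex.ofReal_sub]
    refine ⟨by rw [RCLike.re_to_complex, Complex.ofReal_re], ?_⟩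
    simp only [RCLike.re_to_complex, Complex.ofReal_re]
    have hfi : Integrable (fun x => ‖f x‖) τ :=
      ((Lp.memLp f).integrable (by norm_num)).norm
    have hwf : Integrable (fun x => (1 - β x) * ‖f x‖ ^ 2) τ := by
      simp only [sub_mul, one_mul]
      exact (hsq f).sub (hβsq f)
    -- Cauchy–Schwarz with weight `1 - β` bounds the rank-one part by `∫ (1 - β) ‖f‖²`, because `m`
    -- is the integral of `(1 - β)⁻¹`.
    have h3 := sq_integral_norm_le hw hfi hwf hwi (by rw [hint]; exact hm)
    have h4 : ∫ x, (1 - β x) * ‖f x‖ ^ 2 ∂τ = ∫ x, ‖f x‖ ^ 2 ∂τ - ∫ x, β x * ‖f x‖ ^ 2 ∂τ := by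
      rw [← integral_sub (hsq f) (hβsq f)]
      simp [sub_mul]
    rw [hint, h4] at h3
    have h5 : m⁻¹ * ‖inner ℂ χ f‖ ^ 2 ≤ (∫ x, ‖f x‖ ∂τ) ^ 2 / m := by
      rw [div_eq_inv_mul, hχf]
      gcongr
      exact norm_integral_le_integral_norm _
    linarith
  obtain ⟨ν, hν, hs, h⟩ := exists_measure_resolvent T hT0 hT1 χ
  refine ⟨ν, hν, hs, fun q hq => ?_⟩
  have hq1 : ∀ x, 0 < 1 + q * β x := fun x => by
    rcases le_total 0 q with h | h
    · linarith [mul_nonneg h (h0 x)]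
    · nlinarith [mul_nonneg (neg_nonneg.2 h) (hw x).le]
  have hqm : Measurable fun x => (1 + q * β x)⁻¹ := by fun_prop
  have hqb : ∃ c, ∀ x, (1 + q * β x)⁻¹ ≤ c := by
    rcases le_total 0 q with h | h
    · exact ⟨1, fun x => inv_le_one_of_one_le₀ (by linarith [mul_nonneg h (h0 x)])⟩
    · refine ⟨(1 - b)⁻¹, fun x => inv_anti₀ (by linarith) ?_⟩
      nlinarith [mul_nonneg (by linarith : 0 ≤ 1 + q) (h0 x), h1 x]
  obtain ⟨c, hc⟩ := hqb
  have hqi : Integrable (fun x => (1 + q * β x)⁻¹) τ := hbm hqm fun x => by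
    rw [abs_of_pos (inv_pos.2 (hq1 x))]; exact hc x
  set X := ∫ x, (1 + q * β x)⁻¹ ∂τ with hX
  have hX0 : 0 ≤ X := integral_nonneg fun x => (inv_pos.2 (hq1 x)).le
  have hmX : 0 < m + q * X := by
    rcases le_total 0 q with h | h
    · positivity
    · have : X ≤ m := by
        rw [← hint]
        refine integral_mono hqi hwi fun x => inv_anti₀ (hw x) ?_
        nlinarith [mul_nonneg (by linarith : 0 ≤ 1 + q) (h0 x)]
      nlinarith
  -- The solution of `y + q T y = χ`: it must be a multiple of `(1 + q β)⁻¹`, and pairing with `χ`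
  -- fixes the factor.
  have hyL : MemLp (fun x => ((m / (m + q * X) * (1 + q * β x)⁻¹ : ℝ) : ℂ)) 2 τ :=
    MemLp.of_bound (by fun_prop) (m / (m + q * X) * c) (Eventually.of_forall fun x => by
      rw [Complex.norm_real, Real.norm_eq_abs, abs_of_pos (mul_pos (by positivity) (inv_pos.2 (hq1 x)))]
      gcongr; exact hc x)
  have hy : (hyL.toLp : Lp ℂ 2 τ) =ᵐ[τ] _ := hyL.coeFn_toLp
  have hiy : inner ℂ χ (hyL.toLp : Lp ℂ 2 τ) = ((m / (m + q * X) * X : ℝ) : ℂ) := by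
    rw [hχf, integral_congr_ae hy, integral_complex_ofReal, integral_const_mul]
  have key := h q hq hyL.toLp (by
    refine Lp.ext ?_
    rw [hTapp, hiy]
    filter_upwards [hχ, hy, hM hyL.toLp, Lp.coeFn_add (hyL.toLp : Lp ℂ 2 τ) ((q : ℂ) •
      (M hyL.toLp + ((m⁻¹ : ℝ) : ℂ) • (((m / (m + q * X) * X : ℝ) : ℂ) • χ))),
      Lp.coeFn_smul (q : ℂ) (M hyL.toLp + ((m⁻¹ : ℝ) : ℂ) • (((m / (m + q * X) * X : ℝ) : ℂ) • χ)),
      Lp.coeFn_add (M hyL.toLp) (((m⁻¹ : ℝ) : ℂ) • (((m / (m + q * X) * X : ℝ) : ℂ) • χ)),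
      Lp.coeFn_smul ((m⁻¹ : ℝ) : ℂ) (((m / (m + q * X) * X : ℝ) : ℂ) • χ),
      Lp.coeFn_smul ((m / (m + q * X) * X : ℝ) : ℂ) χ] with x g1 g2 g3 g4 g5 g6 g7 g8
    rw [g4, Pi.add_apply, g5, Pi.smul_apply, g6, Pi.add_apply, g7, Pi.smul_apply, g8, Pi.smul_apply,
      g3, g2, g1]
    simp only [smul_eq_mul, mul_one, ← Complex.ofReal_mul, ← Complex.ofReal_add,
      ← Complex.ofReal_one]
    congr 1
    have := (hq1 x).ne'
    have := hmX.ne'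
    field_simp
    ring)
  rw [key, hiy, Complex.ofReal_re]
  have := hmX.ne'
  field_simp
  ring

end RankOne

/-! ### Divided differences of the exponent -/

section Stieltjes

variable {σ : Measure ℝ}

theorem integrable_inv_add (h0 : ∀ᵐ s ∂σ, 0 ≤ s) (hσ : Integrable (fun s => (1 + s)⁻¹) σ)
    {p : ℝ} (hp : 0 < p) : Integrable (fun s => (p + s)⁻¹) σ := by
  refine (hσ.const_mul (max 1 p⁻¹)).mono' (by fun_prop) ?_
  filter_upwards [h0] with s hs
  rw [Real.norm_eq_abs, abs_of_pos (by positivity), ← div_eq_mul_inv, le_div_iff₀ (by positivity),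
    inv_mul_le_iff₀ (by positivity)]
  have h1 : 1 ≤ max 1 p⁻¹ := le_max_left _ _
  have h2 : p * p⁻¹ ≤ p * max 1 p⁻¹ := by gcongr; exact le_max_right _ _
  rw [mul_inv_cancel₀ hp.ne'] at h2
  nlinarith

theorem div_mul_add_le_inv {p r s : ℝ} (hp : 0 < p) (hr : 0 < r) (hs : 0 ≤ s) :
    s / ((p + s) * (r + s)) ≤ (p + s)⁻¹ := by
  rw [div_le_iff₀ (by positivity), inv_mul_cancel_left₀ (by positivity)]
  linarith

theorem integrable_div_mul_add (h0 : ∀ᵐ s ∂σ, 0 ≤ s) (hσ : Integrable (fun s => (1 + s)⁻¹) σ)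
    {p r : ℝ} (hp : 0 < p) (hr : 0 < r) : Integrable (fun s => s / ((p + s) * (r + s))) σ := by
  refine (integrable_inv_add h0 hσ hp).mono' (Measurable.aestronglyMeasurable (by fun_prop)) ?_
  filter_upwards [h0] with s hs
  rw [Real.norm_eq_abs, abs_of_nonneg (by positivity)]
  exact div_mul_add_le_inv hp hr hs

/-- The divided difference of `p ↦ ∫ p / (p + s) dσ(s)`. -/
noncomputable def stieltjesSlope (σ : Measure ℝ) (p r : ℝ) : ℝ :=
  ∫ s, s / ((p + s) * (r + s)) ∂σ

theorem mul_integral_sub_mul_integral (h0 : ∀ᵐ s ∂σ, 0 ≤ s)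
    (hσ : Integrable (fun s => (1 + s)⁻¹) σ) {p r : ℝ} (hp : 0 < p) (hr : 0 < r) :
    p * ∫ s, (p + s)⁻¹ ∂σ - r * ∫ s, (r + s)⁻¹ ∂σ = (p - r) * stieltjesSlope σ p r := by
  rw [stieltjesSlope, ← integral_const_mul, ← integral_const_mul, ← integral_const_mul,
    ← integral_sub ((integrable_inv_add h0 hσ hp).const_mul _)
      ((integrable_inv_add h0 hσ hr).const_mul _)]
  refine integral_congr_ae ?_
  filter_upwards [h0] with s hs
  have : p + s ≠ 0 := by positivity
  have : r + s ≠ 0 := by positivity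
  field_simp
  ring

theorem stieltjesSlope_nonneg (h0 : ∀ᵐ s ∂σ, 0 ≤ s) {p r : ℝ} (hp : 0 < p) (hr : 0 < r) :
    0 ≤ stieltjesSlope σ p r := by
  refine integral_nonneg_of_ae ?_
  filter_upwards [h0] with s hs
  simp only [Pi.zero_apply]
  positivity

/-- A vanishing integral of a nonnegative integrand forces `s = 0` almost everywhere, and there the
integrand vanishes for all parameters. -/
theorem stieltjesSlope_eq_zero (h0 : ∀ᵐ s ∂σ, 0 ≤ s) (hσ : Integrable (fun s => (1 + s)⁻¹) σ)
    {p r : ℝ} (hp : 0 < p) (hr : 0 < r) (h : stieltjesSlope σ p r = 0) (p' r' : ℝ) :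
    stieltjesSlope σ p' r' = 0 := by
  rw [stieltjesSlope, integral_eq_zero_iff_of_nonneg_ae ?_ (integrable_div_mul_add h0 hσ hp hr)] at h
  · refine integral_eq_zero_of_ae ?_
    filter_upwards [h, h0] with s hs hs0
    have : s = 0 := by
      have h1 : p + s ≠ 0 := by positivity
      have h2 : r + s ≠ 0 := by positivity
      simpa [h1, h2] using hs
    simp [this]
  · filter_upwards [h0] with s hs
    simp only [Pi.zero_apply]
    positivity

theorem tendsto_stieltjesSlope (h0 : ∀ᵐ s ∂σ, 0 ≤ s) (hσ : Integrable (fun s => (1 + s)⁻¹) σ)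
    {r : ℝ} (hr : 0 < r) :
    Tendsto (fun p => stieltjesSlope σ p r) (𝓝 r) (𝓝 (stieltjesSlope σ r r)) := by
  refine tendsto_integral_filter_of_dominated_convergence (fun s => (r + s)⁻¹) ?_ ?_
    (integrable_inv_add h0 hσ hr) ?_
  · exact Eventually.of_forall fun p => Measurable.aestronglyMeasurable (by fun_prop)
  · filter_upwards [lt_mem_nhds hr] with p hp
    filter_upwards [h0] with s hs
    rw [Real.norm_eq_abs, abs_of_nonneg (by positivity), mul_comm]
    exact div_mul_add_le_inv hr hp hs
  · filter_upwards [h0] with s hs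
    have h1 : r + s ≠ 0 := by positivity
    have : ContinuousAt (fun p => s / ((p + s) * (r + s))) r :=
      ContinuousAt.div₀ (by fun_prop) (by fun_prop) (mul_ne_zero h1 h1)
    exact this

end Stieltjes

/-- The limits of `𝒦` at infinity and of `p 𝒦(p)` at zero bound `b` and `a` from above by 0. -/
theorem IsAdmissibleKernel.exists_measure {k : ℝ → ℝ} (hk : IsAdmissibleKernel k) :
    ∃ σ : Measure ℝ, (∀ᵐ s ∂σ, 0 ≤ s) ∧ Integrable (fun s => (1 + s)⁻¹) σ ∧
      ∀ p : ℝ, 0 < p → laplaceTransform k p = ∫ s, (p + s)⁻¹ ∂σ := by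
  obtain ⟨a, b, σ, ha, hb, hσ, h⟩ := hk.stieltjes
  have hI : ∀ p : ℝ, 0 < p → 0 ≤ ∫ t in Ici (0 : ℝ), (p + t)⁻¹ ∂σ := fun p hp =>
    setIntegral_nonneg measurableSet_Ici fun t (ht : 0 ≤ t) => by positivity
  have hb0 : b = 0 := le_antisymm (ge_of_tendsto hk.tendsto_top (by
    filter_upwards [eventually_gt_atTop 0] with p hp
    rw [h p hp]
    have := hI p hp
    have : 0 ≤ a / p := by positivity
    linarith)) hb
  have ha0 : a = 0 := le_antisymm (ge_of_tendsto hk.mul_tendsto_zero (by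
    filter_upwards [self_mem_nhdsWithin] with p (hp : 0 < p)
    rw [h p hp, mul_add, mul_add, mul_div_cancel₀ _ hp.ne']
    have := mul_nonneg hp.le (hI p hp)
    have := mul_nonneg hp.le hb
    linarith)) ha
  refine ⟨σ.restrict (Ici 0), ae_restrict_mem measurableSet_Ici, hσ, fun p hp => ?_⟩
  rw [h p hp, ha0, hb0]; simp

/-! ### Monotonicity and differentiability of `Φ` -/

section Exponent

variable {k : ℝ → ℝ} {σ : Measure ℝ}

theorem laplaceExponent_sub (h0 : ∀ᵐ s ∂σ, 0 ≤ s)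
    (hσ : Integrable (fun s => (1 + s)⁻¹) σ)
    (h : ∀ p : ℝ, 0 < p → laplaceTransform k p = ∫ s, (p + s)⁻¹ ∂σ)
    {p r : ℝ} (hp : 0 < p) (hr : 0 < r) :
    laplaceExponent k p - laplaceExponent k r = (p - r) * stieltjesSlope σ p r := by
  rw [laplaceExponent, laplaceExponent, h p hp, h r hr, mul_integral_sub_mul_integral h0 hσ hp hr]

/-- If one divided difference vanished, all would, and `Φ` would be constant, against `Φ(p) → ∞`. -/
theorem IsAdmissibleKernel.stieltjesSlope_pos (hk : IsAdmissibleKernel k) (h0 : ∀ᵐ s ∂σ, 0 ≤ s)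
    (hσ : Integrable (fun s => (1 + s)⁻¹) σ)
    (h : ∀ p : ℝ, 0 < p → laplaceTransform k p = ∫ s, (p + s)⁻¹ ∂σ)
    {p r : ℝ} (hp : 0 < p) (hr : 0 < r) : 0 < stieltjesSlope σ p r := by
  refine (stieltjesSlope_nonneg h0 hp hr).lt_of_ne fun hz => ?_
  have hconst : ∀ p : ℝ, 0 < p → laplaceExponent k p = laplaceExponent k 1 := fun x hx => by
    have := laplaceExponent_sub h0 hσ h hx one_pos
    rw [stieltjesSlope_eq_zero h0 hσ hp hr hz.symm] at this
    linarith
  refine not_tendsto_const_atTop (laplaceExponent k 1) (atTop : Filter ℝ) ?_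
  refine hk.mul_tendsto_top.congr' ?_
  filter_upwards [eventually_gt_atTop 0] with p hp using hconst p hp

theorem hasDerivAt_laplaceExponent (h0 : ∀ᵐ s ∂σ, 0 ≤ s)
    (hσ : Integrable (fun s => (1 + s)⁻¹) σ)
    (h : ∀ p : ℝ, 0 < p → laplaceTransform k p = ∫ s, (p + s)⁻¹ ∂σ)
    {r : ℝ} (hr : 0 < r) : HasDerivAt (laplaceExponent k) (stieltjesSlope σ r r) r := by
  rw [hasDerivAt_iff_tendsto_slope]
  refine ((tendsto_stieltjesSlope h0 hσ hr).mono_left nhdsWithin_le_nhds).congr' ?_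
  filter_upwards [mem_nhdsWithin_of_mem_nhds (lt_mem_nhds hr), self_mem_nhdsWithin] with p hp hpr
  rw [slope_def_field, laplaceExponent_sub h0 hσ h hp hr, mul_div_cancel_left₀]
  exact sub_ne_zero.2 hpr

theorem IsAdmissibleKernel.exists_laplaceExponent_eq (hk : IsAdmissibleKernel k)
    (h0 : ∀ᵐ s ∂σ, 0 ≤ s) (hσ : Integrable (fun s => (1 + s)⁻¹) σ)
    (h : ∀ p : ℝ, 0 < p → laplaceTransform k p = ∫ s, (p + s)⁻¹ ∂σ) {lam : ℝ} (hlam : 0 < lam) :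
    ∃ p : ℝ, 0 < p ∧ laplaceExponent k p = lam := by
  have hc : ContinuousOn (laplaceExponent k) (Ioi 0) := fun r (hr : 0 < r) =>
    (hasDerivAt_laplaceExponent h0 hσ h hr).continuousAt.continuousWithinAt
  obtain ⟨a, ha, ha0⟩ := ((hk.mul_tendsto_zero.eventually (gt_mem_nhds hlam)).and
    self_mem_nhdsWithin).exists
  obtain ⟨b, hb, hb0⟩ := ((hk.mul_tendsto_top.eventually (eventually_gt_atTop lam)).and
    (eventually_gt_atTop 0)).exists
  exact isPreconnected_Ioi.intermediate_value ha0 hb0 hc ⟨ha.le, hb.le⟩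

theorem IsAdmissibleKernel.laplaceExponent_injOn (hk : IsAdmissibleKernel k)
    (h0 : ∀ᵐ s ∂σ, 0 ≤ s) (hσ : Integrable (fun s => (1 + s)⁻¹) σ)
    (h : ∀ p : ℝ, 0 < p → laplaceTransform k p = ∫ s, (p + s)⁻¹ ∂σ) :
    InjOn (laplaceExponent k) (Ioi 0) := fun p hp r hr hpr => by
  have h1 := laplaceExponent_sub h0 hσ h hp hr
  rw [hpr, sub_self, eq_comm, mul_eq_zero] at h1
  exact sub_eq_zero.1 (h1.resolve_right (hk.stieltjesSlope_pos h0 hσ h hp hr).ne')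

end Exponent

/-! ### Stieltjes representation of `1 / (Φ(p₀ + z) - lam)` -/

theorem integral_withDensity_ofReal {α : Type*} [MeasurableSpace α] {μ : Measure α} {w : α → ℝ}
    (hw : Measurable w) (h0 : ∀ᵐ x ∂μ, 0 ≤ w x) (g : α → ℝ) :
    ∫ x, g x ∂(μ.withDensity fun x => ENNReal.ofReal (w x)) = ∫ x, w x * g x ∂μ := by
  rw [integral_withDensity_eq_integral_toReal_smul (by fun_prop) (by simp)]
  refine integral_congr_ae ?_
  filter_upwards [h0] with x hx
  simp [hx]

/-- If `∫ q / (1 + q s) dν(s) → m` as `q → ∞`, then `∫ dν(s) / s = m`. -/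
theorem integral_inv_of_tendsto {ν : Measure ℝ} [IsFiniteMeasure ν]
    (hs : ∀ᵐ s ∂ν, 0 ≤ s) {m : ℝ}
    (h : Tendsto (fun q : ℝ => q * ∫ s, (1 + q * s)⁻¹ ∂ν) atTop (𝓝 m)) :
    (∀ᵐ s ∂ν, 0 < s) ∧ Integrable (fun s => s⁻¹) ν ∧ ∫ s, s⁻¹ ∂ν = m := by
  have hn : Tendsto (fun n : ℕ => ∫ s : ℝ, (n : ℝ) * (1 + n * s)⁻¹ ∂ν) atTop (𝓝 m) := by
    refine (h.comp tendsto_natCast_atTop_atTop).congr fun n => ?_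
    simp [integral_const_mul]
  have hbd : ∀ n : ℕ, ∀ᵐ s : ℝ ∂ν, ‖(n : ℝ) * (1 + n * s)⁻¹‖ ≤ n := fun n => by
    filter_upwards [hs] with s hs
    rw [Real.norm_eq_abs, abs_of_nonneg (by positivity)]
    refine mul_le_of_le_one_right (by positivity) (inv_le_one_of_one_le₀ ?_)
    have : 0 ≤ n * s := by positivity
    linarith
  have hint : ∀ n : ℕ, Integrable (fun s : ℝ => (n : ℝ) * (1 + n * s)⁻¹) ν := fun n =>
    Integrable.of_bound (Measurable.aestronglyMeasurable (by fun_prop)) _ (hbd n)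
  have hnn : ∀ n : ℕ, ∀ᵐ s : ℝ ∂ν, 0 ≤ (n : ℝ) * (1 + n * s)⁻¹ := fun n => by
    filter_upwards [hs] with s hs using by positivity
  -- An atom at 0 would contribute `n ν{0}`, which is unbounded.
  have hz : ν {0} = 0 := by
    by_contra hne
    have hpos : 0 < ν.real {0} := ENNReal.toReal_pos hne (measure_ne_top _ _)
    refine not_tendsto_nhds_of_tendsto_atTop ?_ m hn
    refine tendsto_atTop_mono (fun n => ?_)
      (tendsto_natCast_atTop_atTop.atTop_mul_const hpos : Tendsto (fun n : ℕ => (n : ℝ) * ν.real {0}) _ _)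
    calc (n : ℝ) * ν.real {0} = ∫ s in {0}, (n : ℝ) * (1 + n * s)⁻¹ ∂ν := by
          rw [integral_singleton]; simp [mul_comm]
      _ ≤ _ := setIntegral_le_integral (hint n) (hnn n)
  have hpos : ∀ᵐ s ∂ν, 0 < s := by
    have : ∀ᵐ s ∂ν, s ≠ 0 := by
      rw [ae_iff]; simpa using hz
    filter_upwards [hs, this] with s h1 h2 using lt_of_le_of_ne h1 h2.symm
  have hmono : ∀ᵐ s : ℝ ∂ν, Monotone fun n : ℕ => ENNReal.ofReal ((n : ℝ) * (1 + n * s)⁻¹) := by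
    filter_upwards [hs] with s hs n n' hnn'
    refine ENNReal.ofReal_le_ofReal ?_
    have : (n : ℝ) ≤ n' := by exact_mod_cast hnn'
    rw [← div_eq_mul_inv, ← div_eq_mul_inv, div_le_div_iff₀ (by positivity) (by positivity)]
    nlinarith
  have hlim : ∀ᵐ s : ℝ ∂ν, Tendsto (fun n : ℕ => (n : ℝ) * (1 + n * s)⁻¹) atTop (𝓝 s⁻¹) := by
    filter_upwards [hpos] with s hs
    have h1 : Tendsto (fun n : ℕ => ((n : ℝ)⁻¹ + s)⁻¹) atTop (𝓝 (0 + s)⁻¹) :=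
      (tendsto_inv_atTop_nhds_zero_nat.add_const s).inv₀ (by simpa using hs.ne')
    rw [zero_add] at h1
    refine h1.congr' ?_
    filter_upwards [eventually_gt_atTop 0] with n hn
    have : (0 : ℝ) < n := by exact_mod_cast hn
    have h2 : (1 + n * s) ≠ 0 := by positivity
    have h3 : (n : ℝ)⁻¹ + s ≠ 0 := by positivity
    field_simp
  have hL := lintegral_tendsto_of_tendsto_of_monotone (μ := ν)
    (fun n => (Measurable.aemeasurable (by fun_prop))) hmono
    (hlim.mono fun s hs => (ENNReal.continuous_ofReal.tendsto _).comp hs)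
  have hL' : Tendsto (fun n : ℕ => ∫⁻ s : ℝ, ENNReal.ofReal ((n : ℝ) * (1 + n * s)⁻¹) ∂ν) atTop
      (𝓝 (ENNReal.ofReal m)) := by
    refine ((ENNReal.continuous_ofReal.tendsto _).comp hn).congr fun n => ?_
    exact ofReal_integral_eq_lintegral_ofReal (hint n) (hnn n)
  have heq := tendsto_nhds_unique hL hL'
  have hnn' : 0 ≤ᵐ[ν] fun s : ℝ => s⁻¹ := hpos.mono fun s hs => (inv_pos.2 hs).le
  have hm : 0 ≤ m := ge_of_tendsto' hn fun n => integral_nonneg_of_ae (hnn n)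
  refine ⟨hpos, ⟨Measurable.aestronglyMeasurable (by fun_prop), ?_⟩, ?_⟩
  · rw [hasFiniteIntegral_iff_ofReal hnn', heq]; exact ENNReal.ofReal_lt_top
  · rw [integral_eq_lintegral_of_nonneg_ae hnn' (Measurable.aestronglyMeasurable (by fun_prop)),
      heq, ENNReal.toReal_ofReal hm]

/-- The function `z ↦ 1 / (Φ(p₀ + z) - lam)` is a Stieltjes function. -/
theorem IsAdmissibleKernel.exists_resolvent_measure {k : ℝ → ℝ} (hk : IsAdmissibleKernel k)
    {lam p₀ : ℝ} (hp₀ : 0 < p₀) (hlam : laplaceExponent k p₀ = lam) :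
    ∃ τ : Measure ℝ, IsFiniteMeasure τ ∧ (∀ᵐ s ∂τ, 0 ≤ s) ∧ ∀ z : ℝ, 0 < z →
      (laplaceExponent k (p₀ + z) - lam)⁻¹ = ∫ s, (1 + s) / (z + s) ∂τ := by
  obtain ⟨σ, h0, hσ, h⟩ := hk.exists_measure
  -- Base point `z = 1`: then `q = z - 1` turns `z > 0` into `q > -1`, and `p₁ > 1` keeps `β` below
  -- a constant less than 1.
  set p₁ := p₀ + 1 with hp₁
  have hp₁0 : 0 < p₁ := by positivity
  set m := stieltjesSlope σ p₁ p₀ with hm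
  have hm0 : 0 < m := hk.stieltjesSlope_pos h0 hσ h hp₁0 hp₀
  let w : ℝ → ℝ := fun s => s / ((p₁ + s) * (p₁ + s))
  have hw : Measurable w := by fun_prop
  have hw0 : ∀ᵐ s ∂σ, 0 ≤ w s := by
    filter_upwards [h0] with s hs
    simp only [w]; positivity
  let τ₁ := σ.withDensity fun s => ENNReal.ofReal (w s)
  have hτ₁ : IsFiniteMeasure τ₁ :=
    isFiniteMeasure_withDensity_ofReal (integrable_div_mul_add h0 hσ hp₁0 hp₁0).2
  -- The truncation `max s 0` makes the bounds on `β` hold everywhere, not just almost everywhere.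
  let β : ℝ → ℝ := fun s => (p₁ + max s 0)⁻¹
  have hβ0 : ∀ s, 0 ≤ β s := fun s => by positivity
  have hβ1 : ∀ s, β s ≤ p₁⁻¹ := fun s => inv_anti₀ hp₁0 (by simp)
  have hX : ∀ z : ℝ, 0 < p₀ + z → ∫ s, (1 + (z - 1) * β s)⁻¹ ∂τ₁ = stieltjesSlope σ p₁ (p₀ + z) := by
    intro z hz
    rw [integral_withDensity_ofReal hw hw0]
    refine integral_congr_ae ?_
    filter_upwards [h0] with s hs
    have h1 : p₁ + s ≠ 0 := by positivity
    have h2 : p₀ + z + s ≠ 0 := by positivity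
    have h3 : 1 + (z - 1) * (p₁ + s)⁻¹ = (p₀ + z + s) / (p₁ + s) := by
      field_simp; rw [hp₁]; ring
    simp only [w, β, max_eq_left hs, h3]
    field_simp
  -- This is the case `z = 0`, `q = -1`: it encodes `Φ(p₀) = lam`.
  have hmint : ∫ s, (1 - β s)⁻¹ ∂τ₁ = m := by
    have := hX 0 (by simpa using hp₀)
    simpa [← sub_eq_add_neg] using this
  obtain ⟨ν, hν, hs, hres⟩ := exists_measure_rankOne_perturbation τ₁ (β := β) (by fun_prop)
    (inv_lt_one_of_one_lt₀ (by linarith : 1 < p₁)) hβ0 hβ1 hm0 hmint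
  have hs0 : ∀ᵐ s ∂ν, 0 ≤ s := hs.mono fun s hs => hs.1
  have hΦ : ∀ z : ℝ, 0 < z → laplaceExponent k (p₀ + z) - lam
      = m + (z - 1) * ∫ s, (1 + (z - 1) * β s)⁻¹ ∂τ₁ := fun z hz => by
    have h1 := laplaceExponent_sub h0 hσ h hp₁0 hp₀
    have h2 := laplaceExponent_sub h0 hσ h hp₁0 (by positivity : 0 < p₀ + z)
    rw [hlam, hp₁, add_sub_cancel_left, one_mul, ← hp₁, ← hm] at h1
    rw [hX z (by positivity)]
    linear_combination h1 - h2 - (stieltjesSlope σ p₁ (p₀ + z)) * hp₁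
  have hG : ∀ z : ℝ, 0 < z → (laplaceExponent k (p₀ + z) - lam)⁻¹
      = m⁻¹ - (z - 1) / m ^ 2 * ∫ s, (1 + (z - 1) * s)⁻¹ ∂ν := fun z hz => by
    rw [hΦ z hz, hres (z - 1) (by linarith)]
  -- From `Φ → ∞` the reciprocal tends to 0. This gives `∫ dν(s) / s = m`, which absorbs the
  -- constant term `m⁻¹` of the representation.
  have hlim : Tendsto (fun q : ℝ => q * ∫ s, (1 + q * s)⁻¹ ∂ν) atTop (𝓝 m) := by
    have h1 : Tendsto (fun q : ℝ => (laplaceExponent k (p₀ + (q + 1)) - lam)⁻¹) atTop (𝓝 0) := by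
      refine tendsto_inv_atTop_zero.comp (tendsto_atTop_add_const_right _ _ ?_)
      exact hk.mul_tendsto_top.comp (tendsto_atTop_add_const_left _ _
        (tendsto_atTop_add_const_right _ _ tendsto_id))
    have h2 := (h1.const_sub m⁻¹).const_mul (m ^ 2)
    rw [show m ^ 2 * (m⁻¹ - 0) = m by field_simp; ring] at h2
    refine h2.congr' ?_
    filter_upwards [eventually_gt_atTop 0] with q hq
    rw [hG (q + 1) (by positivity), add_sub_cancel_right]
    field_simp
    ring
  obtain ⟨hpos, hinv, hinvm⟩ := integral_inv_of_tendsto hs0 hlim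
  -- The integrand becomes `m⁻² (1/s - q / (1 + q s)) = m⁻² / (s (1 + q s))`. Under `s ↦ 1/s - 1`
  -- this is the weight `(m² s)⁻¹` times the kernel `(1 + s') / (z + s')` in the new variable `s'`.
  let w' : ℝ → ℝ := fun s => (m ^ 2 * s)⁻¹
  have hw' : Measurable w' := by fun_prop
  have hw'0 : ∀ᵐ s ∂ν, 0 ≤ w' s := by
    filter_upwards [hs0] with s hs
    simp only [w']; positivity
  have hfin : IsFiniteMeasure (ν.withDensity fun s => ENNReal.ofReal (w' s)) := by
    refine isFiniteMeasure_withDensity_ofReal (Integrable.hasFiniteIntegral ?_)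
    simpa [w', mul_inv, mul_comm] using hinv.mul_const (m ^ 2)⁻¹
  have hT : Measurable fun s : ℝ => s⁻¹ - 1 := by fun_prop
  refine ⟨(ν.withDensity fun s => ENNReal.ofReal (w' s)).map fun s => s⁻¹ - 1,
    inferInstance, ?_, fun z hz => ?_⟩
  · refine (ae_map_iff hT.aemeasurable measurableSet_Ici).2 ?_
    refine (withDensity_absolutelyContinuous _ _).ae_le ?_
    filter_upwards [hs, hpos] with s h1 h2
    exact sub_nonneg.2 (one_le_inv_iff₀.2 ⟨h2, h1.2⟩)
  · rw [integral_map hT.aemeasurable (Measurable.aestronglyMeasurable (by fun_prop)),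
      integral_withDensity_ofReal hw' hw'0, hG z hz]
    have hq : Integrable (fun s => (1 + (z - 1) * s)⁻¹) ν := by
      refine Integrable.of_bound (C := max 1 z⁻¹) (Measurable.aestronglyMeasurable (by fun_prop)) ?_
      filter_upwards [hs] with s hs
      have h1 : min 1 z ≤ 1 + (z - 1) * s := by
        rcases le_total 1 z with h | h
        · exact (min_le_left _ _).trans (by nlinarith [mul_nonneg (sub_nonneg.2 h) hs.1])
        · exact (min_le_right _ _).trans (by nlinarith [mul_nonneg (sub_nonneg.2 h) (sub_nonneg.2 hs.2)])
      have h2 : 0 < min 1 z := lt_min one_pos hz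
      rw [Real.norm_eq_abs, abs_of_pos (inv_pos.2 (h2.trans_le h1))]
      refine (inv_anti₀ h2 h1).trans ?_
      rcases le_total 1 z with h | h
      · simp [min_eq_left h]
      · simp [min_eq_right h]
    have h1 : m⁻¹ = (m ^ 2)⁻¹ * ∫ s, s⁻¹ ∂ν := by rw [hinvm]; field_simp
    rw [h1, ← integral_const_mul, ← integral_const_mul, ← integral_sub (hinv.const_mul _) (hq.const_mul _)]
    refine integral_congr_ae ?_
    filter_upwards [hs, hpos] with s hs hpos
    have h2 : 1 + (z - 1) * s = s * (z + (s⁻¹ - 1)) := by field_simp; ring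
    have h3 : 0 < z + (s⁻¹ - 1) := by
      have : 1 ≤ s⁻¹ := one_le_inv_iff₀.2 ⟨hpos, hs.2⟩
      linarith
    have h4 : 1 + (s⁻¹ - 1) = s⁻¹ := by ring
    have h5 : z - 1 = (z + (s⁻¹ - 1)) - s⁻¹ := by ring
    simp only [w']
    rw [h2, h4, h5]
    set d := z + (s⁻¹ - 1)
    field_simp
    ring

/-- The completely monotone function `t ↦ ∫ (1 + s) e^{-st} dτ(s)`. -/
noncomputable def mixedExp (τ : Measure ℝ) (t : ℝ) : ℝ :=
  ∫ s, (1 + s) * Real.exp (-(s * t)) ∂τ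

/-! ### Laplace transform and limit of the completely monotone factor -/

section MixedExp

variable {τ : Measure ℝ} [IsFiniteMeasure τ]

theorem integrableOn_laplace_mixedExp (h0 : ∀ᵐ s ∂τ, 0 ≤ s) {z : ℝ} (hz : 0 < z) :
    IntegrableOn (fun t => Real.exp (-(z * t)) * mixedExp τ t) (Ioi 0) ∧
      ∫ t in Ioi (0 : ℝ), Real.exp (-(z * t)) * mixedExp τ t = ∫ s, (1 + s) / (z + s) ∂τ := by
  let F : ℝ × ℝ → ℝ := fun q => Real.exp (-(z * q.1)) * ((1 + q.2) * Real.exp (-(q.2 * q.1)))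
  have hF : ∀ s : ℝ, (fun t => F (t, s)) = fun t => (1 + s) * Real.exp (-(z + s) * t) := by
    intro s; ext t
    simp only [F]
    rw [mul_left_comm, ← Real.exp_add]; ring_nf
  have hexp : ∀ s : ℝ, 0 ≤ s → IntegrableOn (fun t => (1 + s) * Real.exp (-(z + s) * t)) (Ioi 0) :=
    fun s hs => (integrableOn_exp_mul_Ioi (by linarith) 0).const_mul _
  have hval : ∀ s : ℝ, 0 ≤ s →
      ∫ t in Ioi (0 : ℝ), (1 + s) * Real.exp (-(z + s) * t) = (1 + s) / (z + s) := fun s hs => by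
    rw [integral_const_mul, integral_exp_mul_Ioi (by linarith)]
    rw [mul_zero, Real.exp_zero, neg_div_neg_eq, mul_one_div]
  have hi : Integrable F ((volume.restrict (Ioi 0)).prod τ) := by
    rw [integrable_prod_iff' (Continuous.aestronglyMeasurable (by fun_prop))]
    constructor
    · filter_upwards [h0] with s hs
      rw [hF]; exact hexp s hs
    · refine Integrable.of_bound (C := max 1 z⁻¹) ?_ ?_
      · exact (Continuous.stronglyMeasurable (by fun_prop : Continuous fun q : ℝ × ℝ =>
          ‖F (q.2, q.1)‖)).integral_prod_right.aestronglyMeasurable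
      · filter_upwards [h0] with s hs
        have : ∫ t in Ioi (0 : ℝ), ‖F (t, s)‖ = (1 + s) / (z + s) := by
          rw [← hval s hs]
          refine integral_congr_ae (Eventually.of_forall fun t => ?_)
          have := congrFun (hF s) t
          simp only at this ⊢
          rw [this, Real.norm_eq_abs, abs_of_nonneg (by positivity)]
        rw [this, Real.norm_eq_abs, abs_of_nonneg (by positivity), div_le_iff₀ (by positivity)]
        have h1 : 1 ≤ max 1 z⁻¹ := le_max_left _ _
        have h2 : z⁻¹ * z ≤ max 1 z⁻¹ * z := by gcongr; exact le_max_right _ _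
        rw [inv_mul_cancel₀ hz.ne'] at h2
        nlinarith
  have hFt : ∀ t, ∫ s, F (t, s) ∂τ = Real.exp (-(z * t)) * mixedExp τ t := fun t => by
    simp only [F, mixedExp, integral_const_mul]
  constructor
  · have := hi.integral_prod_left
    simp only [hFt] at this
    exact this
  · have := integral_integral_swap (f := fun t s => F (t, s)) hi
    simp only [hFt] at this
    rw [this]
    refine integral_congr_ae ?_
    filter_upwards [h0] with s hs
    rw [hF, hval s hs]

/-- Dominated convergence: for `t ≥ 1` the integrand is at most 1 because `1 + s ≤ 1 + s t ≤
e^{st}`, and only the atom at 0 survives. -/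
theorem tendsto_mixedExp (h0 : ∀ᵐ s ∂τ, 0 ≤ s) :
    Tendsto (mixedExp τ) atTop (𝓝 (τ.real {0})) := by
  have : τ.real {0} = ∫ s, ({0} : Set ℝ).indicator (fun _ => (1 : ℝ)) s ∂τ := by
    rw [integral_indicator_const _ (measurableSet_singleton _)]; simp
  rw [this]
  refine tendsto_integral_filter_of_dominated_convergence (fun _ => 1) ?_ ?_
    (integrable_const _) ?_
  · exact Eventually.of_forall fun t => Continuous.aestronglyMeasurable (by fun_prop)
  · filter_upwards [eventually_ge_atTop 1] with t ht
    filter_upwards [h0] with s hs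
    rw [Real.norm_eq_abs, abs_of_nonneg (by positivity), Real.exp_neg, ← div_eq_mul_inv,
      div_le_one (by positivity)]
    have := Real.add_one_le_exp (s * t)
    nlinarith
  · filter_upwards [h0] with s hs
    rcases hs.eq_or_lt with rfl | hs
    · simp
    · have h1 : Tendsto (fun t : ℝ => Real.exp (-(s * t))) atTop (𝓝 0) :=
        Real.tendsto_exp_neg_atTop_nhds_zero.comp (tendsto_id.const_mul_atTop hs)
      simpa [hs.ne'] using h1.const_mul (1 + s)

theorem tendsto_mul_integral_div (h0 : ∀ᵐ s ∂τ, 0 ≤ s) :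
    Tendsto (fun z : ℝ => z * ∫ s, (1 + s) / (z + s) ∂τ) (𝓝[>] 0) (𝓝 (τ.real {0})) := by
  have : τ.real {0} = ∫ s, ({0} : Set ℝ).indicator (fun _ => (1 : ℝ)) s ∂τ := by
    rw [integral_indicator_const _ (measurableSet_singleton _)]; simp
  rw [this]
  simp only [← integral_const_mul]
  refine tendsto_integral_filter_of_dominated_convergence (fun _ => 1) ?_ ?_
    (integrable_const _) ?_
  · exact Eventually.of_forall fun t => Measurable.aestronglyMeasurable (by fun_prop)
  · filter_upwards [self_mem_nhdsWithin, mem_nhdsWithin_of_mem_nhds (gt_mem_nhds one_pos)]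
      with z (hz : 0 < z) hz1
    filter_upwards [h0] with s hs
    rw [Real.norm_eq_abs, abs_of_nonneg (by positivity), ← mul_div_assoc,
      div_le_one (by positivity)]
    nlinarith
  · filter_upwards [h0] with s hs
    rcases hs.eq_or_lt with rfl | hs
    · refine tendsto_const_nhds.congr' ?_
      filter_upwards [self_mem_nhdsWithin] with z (hz : 0 < z)
      simp [hz.ne']
    · have h1 : ContinuousAt (fun z : ℝ => z * ((1 + s) / (z + s))) 0 :=
        continuousAt_id.mul (ContinuousAt.div₀ (by fun_prop) (by fun_prop) (by simpa using hs.ne'))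
      have h2 := h1.tendsto.mono_left (nhdsWithin_le_nhds (s := Ioi 0))
      simpa [hs.ne'] using h2

end MixedExp

/-- Past some `N'` one has `|f| < p ε / 2`, so that part of the integral is at most `(ε/2) e^{pt}`;
the rest is a constant, eventually below the same bound. -/
theorem isLittleO_integral_exp_mul {f : ℝ → ℝ} {p : ℝ} (hp : 0 < p)
    (hi : ∀ T, 0 < T → IntervalIntegrable (fun x => Real.exp (p * x) * f x) volume 0 T)
    (hf : Tendsto f atTop (𝓝 0)) :
    (fun t : ℝ => ∫ x in (0 : ℝ)..t, Real.exp (p * x) * f x) =o[atTop]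
      fun t : ℝ => Real.exp (p * t) := by
  rw [isLittleO_iff]
  intro ε hε
  have hε' : 0 < p * (ε / 2) := by positivity
  obtain ⟨N, hN⟩ := eventually_atTop.1 (hf.norm.eventually (gt_mem_nhds (by simpa using hε')))
  set N' := max N 1
  have hN'0 : 0 < N' := lt_of_lt_of_le one_pos (le_max_right _ _)
  set C := ‖∫ x in (0 : ℝ)..N', Real.exp (p * x) * f x‖
  have hexp : Tendsto (fun t : ℝ => Real.exp (p * t)) atTop atTop :=
    Real.tendsto_exp_atTop.comp (tendsto_id.const_mul_atTop hp)
  filter_upwards [eventually_ge_atTop N', hexp.eventually (eventually_ge_atTop (C / (ε / 2)))]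
    with t ht htC
  have ht0 : 0 < t := hN'0.trans_le ht
  have h1 := (hi N' hN'0)
  have h2 := (hi t ht0)
  have h3 : ‖∫ x in N'..t, Real.exp (p * x) * f x‖ ≤ ε / 2 * Real.exp (p * t) := by
    have hder : ∀ x ∈ uIcc N' t, HasDerivAt (fun x => ε / 2 * Real.exp (p * x))
        (p * (ε / 2) * Real.exp (p * x)) x := fun x _ => by
      have := (((hasDerivAt_id x).const_mul p).exp).const_mul (ε / 2)
      convert! this using 1
      simp; ring
    have h5 : IntervalIntegrable (fun x => p * (ε / 2) * Real.exp (p * x)) volume N' t :=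
      Continuous.intervalIntegrable (by fun_prop) _ _
    have h4 := intervalIntegral.integral_eq_sub_of_hasDerivAt hder h5
    calc _ ≤ ∫ x in N'..t, p * (ε / 2) * Real.exp (p * x) := by
          refine intervalIntegral.norm_integral_le_of_norm_le ht (Eventually.of_forall fun x hx => ?_) h5
          rw [norm_mul, Real.norm_of_nonneg (Real.exp_pos _).le, mul_comm]
          gcongr
          exact (hN x ((le_max_left _ _).trans hx.1.le)).le
      _ ≤ _ := by
          rw [h4]
          have : 0 < ε / 2 * Real.exp (p * N') := by positivity
          linarith
  rw [← intervalIntegral.integral_add_adjacent_intervals h1 (h1.symm.trans h2)]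
  refine (norm_add_le _ _).trans ?_
  rw [Real.norm_of_nonneg (Real.exp_pos _).le]
  rw [div_le_iff₀ (by positivity)] at htC
  linarith

/-! ### Uniqueness of the Laplace transform and the convolution rule -/

section LaplaceUniqueness

open scoped ContDiff

/-- Uniqueness of the Laplace transform, from its values at the natural numbers. -/
theorem ae_eq_zero_of_laplace_eq_zero {f : ℝ → ℝ} (hf : IntegrableOn f (Ioi 0))
    (h : ∀ n : ℕ, ∫ t in Ioi (0 : ℝ), Real.exp (-(n * t)) * f t = 0) :
    ∀ᵐ t ∂volume.restrict (Ioi (0 : ℝ)), f t = 0 := by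
  have hexp1 : ∀ t ∈ Ioi (0 : ℝ), Real.exp (-t) ∈ Icc (0 : ℝ) 1 := fun t (ht : 0 < t) =>
    ⟨(Real.exp_pos _).le, Real.exp_le_one_iff.2 (by linarith)⟩
  have hbdd : ∀ (n : ℕ) (c : ℝ), IntegrableOn (fun t => c * Real.exp (-t) ^ n * f t) (Ioi 0) := by
    intro n c
    refine hf.bdd_mul (c := |c|) (Continuous.aestronglyMeasurable (by fun_prop)) ?_
    filter_upwards [ae_restrict_mem measurableSet_Ioi] with t ht
    rw [norm_mul, Real.norm_eq_abs, norm_pow, Real.norm_of_nonneg (hexp1 t ht).1]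
    exact mul_le_of_le_one_right (abs_nonneg _) (pow_le_one₀ (hexp1 t ht).1 (hexp1 t ht).2)
  have hpoly : ∀ P : Polynomial ℝ,
      IntegrableOn (fun t => P.eval (Real.exp (-t)) * f t) (Ioi 0) ∧
        ∫ t in Ioi (0 : ℝ), P.eval (Real.exp (-t)) * f t = 0 := by
    intro P
    induction P using Polynomial.induction_on' with
    | add P Q hP hQ =>
      simp only [Polynomial.eval_add, add_mul]
      exact ⟨hP.1.add hQ.1, by rw [integral_add hP.1 hQ.1, hP.2, hQ.2, add_zero]⟩
    | monomial n c =>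
      simp only [Polynomial.eval_monomial]
      refine ⟨hbdd n c, ?_⟩
      simp only [mul_assoc]
      rw [integral_const_mul]
      have : ∀ t : ℝ, Real.exp (-t) ^ n = Real.exp (-(n * t)) := fun t => by
        rw [← Real.exp_nat_mul]; ring_nf
      simp only [this, h n, mul_zero]
  rw [ae_restrict_iff' measurableSet_Ioi]
  refine isOpen_Ioi.ae_eq_zero_of_integral_contDiff_smul_eq_zero hf.locallyIntegrableOn
    fun g hg hgc hgs => ?_
  have hg0 : ∀ x ≤ 0, g x = 0 := fun x hx => by
    by_contra hne
    exact absurd (hgs (subset_tsupport g hne)) (notMem_Ioi.2 hx)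
  -- In the variable `x = e^{-t}` the hypothesis kills all polynomials, so Weierstrass approximation
  -- applies to `φ`. At `x = 0` the convention `log 0 = 0` gives `φ 0 = g 0 = 0`, the correct limit
  -- since `g` has compact support.
  let φ : ℝ → ℝ := fun x => g (-Real.log x)
  have hφ : ContinuousOn φ (Icc 0 1) := by
    intro x hx
    rcases hx.1.eq_or_lt with rfl | hx0
    · obtain ⟨R, hR⟩ := hgc.isCompact.isBounded.subset_closedBall 0
      have h1 : φ =ᶠ[𝓝 0] fun _ => (0 : ℝ) := by
        have h2 : ∀ᶠ x : ℝ in 𝓝[≠] 0, R < -Real.log x :=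
          (tendsto_neg_atBot_atTop.comp Real.tendsto_log_nhdsNE_zero).eventually
            (eventually_gt_atTop R)
        rw [eventually_nhdsWithin_iff] at h2
        filter_upwards [h2] with y hy
        by_cases hy0 : y = 0
        · simp only [φ, hy0, Real.log_zero, neg_zero]; exact hg0 0 le_rfl
        · by_contra hne
          have h3 := hR (subset_tsupport g hne)
          rw [mem_closedBall_zero_iff] at h3
          exact absurd ((le_abs_self _).trans h3) (not_le.2 (hy hy0))
      exact (continuousAt_const.congr h1.symm).continuousWithinAt
    · exact (ContinuousAt.comp (g := g) hg.continuous.continuousAt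
        (Real.continuousAt_log hx0.ne').neg).continuousWithinAt
  have hφt : ∀ t, φ (Real.exp (-t)) = g t := fun t => by simp [φ]
  have hgf : IntegrableOn (fun t => g t * f t) (Ioi 0) := by
    obtain ⟨C, hC⟩ := hgc.exists_bound_of_continuous hg.continuous
    exact hf.bdd_mul (c := C) hg.continuous.aestronglyMeasurable (Eventually.of_forall hC)
  simp only [smul_eq_mul]
  rw [← setIntegral_eq_integral_of_forall_compl_eq_zero (s := Ioi 0)
    (fun x hx => by rw [hg0 x (not_lt.1 hx), zero_mul])]
  set I := ∫ t in Ioi (0 : ℝ), ‖f t‖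
  have hI : 0 ≤ I := integral_nonneg fun _ => norm_nonneg _
  have key : ∀ ε > 0, |∫ t in Ioi (0 : ℝ), g t * f t| ≤ ε * I := by
    intro ε hε
    obtain ⟨P, hP⟩ := exists_polynomial_near_of_continuousOn 0 1 φ hφ ε hε
    have h1 : ∫ t in Ioi (0 : ℝ), g t * f t
        = ∫ t in Ioi (0 : ℝ), (g t - P.eval (Real.exp (-t))) * f t := by
      simp only [sub_mul]
      rw [integral_sub hgf (hpoly P).1, (hpoly P).2, sub_zero]
    rw [h1, ← integral_const_mul, ← Real.norm_eq_abs]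
    refine norm_integral_le_of_norm_le (hf.norm.const_mul _) ?_
    filter_upwards [ae_restrict_mem measurableSet_Ioi] with t ht
    rw [norm_mul, ← hφt, Real.norm_eq_abs, abs_sub_comm]
    gcongr
    exact (hP _ (hexp1 t ht)).le
  by_contra hne
  have hpos : 0 < |∫ t in Ioi (0 : ℝ), g t * f t| := abs_pos.2 hne
  have := key (|∫ t in Ioi (0 : ℝ), g t * f t| / (2 * (I + 1))) (by positivity)
  rw [div_mul_eq_mul_div, le_div_iff₀ (by positivity)] at this
  nlinarith

/-- The weight `e^{-(c+1)t}` makes the difference integrable; its transform then vanishes at the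
natural numbers. -/
theorem ae_eq_of_laplace_eq {f g : ℝ → ℝ} {c : ℝ}
    (hf : ∀ p, c < p → IntegrableOn (fun t => Real.exp (-(p * t)) * f t) (Ioi 0))
    (hg : ∀ p, c < p → IntegrableOn (fun t => Real.exp (-(p * t)) * g t) (Ioi 0))
    (h : ∀ p, c < p → laplaceTransform f p = laplaceTransform g p) :
    ∀ᵐ t ∂volume.restrict (Ioi (0 : ℝ)), f t = g t := by
  have hn : ∀ n : ℕ, c < c + 1 + n := fun n => by
    have : (0 : ℝ) ≤ n := n.cast_nonneg
    linarith
  have h0 : c < c + 1 := by linarith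
  have hi : IntegrableOn
      (fun t => Real.exp (-((c + 1) * t)) * f t - Real.exp (-((c + 1) * t)) * g t) (Ioi 0) :=
    (hf _ h0).sub (hg _ h0)
  have := ae_eq_zero_of_laplace_eq_zero hi (fun n => by
      have h1 := h _ (hn n)
      rw [laplaceTransform, laplaceTransform, ← sub_eq_zero,
        ← integral_sub (hf _ (hn n)) (hg _ (hn n))] at h1
      refine Eq.trans ?_ h1
      refine integral_congr_ae (Eventually.of_forall fun t => ?_)
      have : Real.exp (-((c + 1 + n) * t)) = Real.exp (-(n * t)) * Real.exp (-((c + 1) * t)) := by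
        rw [← Real.exp_add]; ring_nf
      simp only [this]
      ring)
  filter_upwards [this] with t ht
  rw [← mul_sub, mul_eq_zero, sub_eq_zero] at ht
  exact ht.resolve_left (Real.exp_pos _).ne'

theorem laplace_kernelConv {f g : ℝ → ℝ} {p : ℝ}
    (hf : IntegrableOn (fun t => Real.exp (-(p * t)) * f t) (Ioi 0))
    (hg : IntegrableOn (fun t => Real.exp (-(p * t)) * g t) (Ioi 0)) :
    IntegrableOn (fun t => Real.exp (-(p * t)) * kernelConv f g t) (Ioi 0) ∧
      laplaceTransform (kernelConv f g) p = laplaceTransform f p * laplaceTransform g p := by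
  have hE : ∀ t : ℝ, Real.exp (-(p * t)) * kernelConv f g t = ∫ τ in (0 : ℝ)..t,
      ContinuousLinearMap.mul ℝ ℝ (Real.exp (-(p * τ)) * g τ)
        (Real.exp (-(p * (t - τ))) * f (t - τ)) := fun t => by
    rw [kernelConv, ← intervalIntegral.integral_const_mul]
    refine intervalIntegral.integral_congr fun τ _ => ?_
    have : Real.exp (-(p * t)) = Real.exp (-(p * τ)) * Real.exp (-(p * (t - τ))) := by
      rw [← Real.exp_add]; ring_nf
    simp only [ContinuousLinearMap.mul_apply', this]
    ring
  constructor
  · have h1 := (integrable_posConvolution hg hf (ContinuousLinearMap.mul ℝ ℝ)).integrableOn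
      (s := Ioi 0)
    refine h1.congr ?_
    filter_upwards [ae_restrict_mem measurableSet_Ioi] with t ht
    rw [hE, posConvolution, indicator_of_mem ht]
  · rw [laplaceTransform]
    simp only [hE]
    rw [integral_posConvolution hg hf, mul_comm (laplaceTransform f p)]
    rfl

end LaplaceUniqueness

/-! ### Convolution on the half-line: truncation and associativity -/

section Convolution

open scoped Convolution

theorem kernelConv_comm (f g : ℝ → ℝ) (t : ℝ) : kernelConv f g t = kernelConv g f t := by
  rw [kernelConv, kernelConv]
  have := intervalIntegral.integral_comp_sub_left (a := 0) (b := t)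
    (fun τ => f τ * g (t - τ)) t
  simp only [sub_sub_cancel, sub_self, sub_zero] at this
  rw [this]
  simp only [mul_comm]

theorem kernelConv_one (f : ℝ → ℝ) (t : ℝ) :
    kernelConv (fun _ => 1) f t = ∫ τ in (0 : ℝ)..t, f τ := by
  simp [kernelConv]

theorem kernelConv_congr_right {f g h : ℝ → ℝ}
    (hgh : ∀ᵐ t ∂volume.restrict (Ioi (0 : ℝ)), g t = h t) {t : ℝ} (ht : 0 ≤ t) :
    kernelConv f g t = kernelConv f h t := by
  rw [kernelConv, kernelConv]
  refine intervalIntegral.integral_congr_ae ?_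
  rw [ae_restrict_iff' measurableSet_Ioi] at hgh
  filter_upwards [hgh] with x hx hxt
  rw [uIoc_of_le ht] at hxt
  rw [hx hxt.1]

section Truncation

variable {f g h : ℝ → ℝ} {T t : ℝ}

/-- Causality: up to time `T` only the values on `(0, T]` matter, so locally integrable functions
can be replaced by integrable ones on the whole line. -/
theorem convolution_indicator_Ioc (ht0 : 0 ≤ t) (htT : t ≤ T) :
    ((Ioc 0 T).indicator g ⋆[ContinuousLinearMap.mul ℝ ℝ] (Ioc 0 T).indicator f) t
      = kernelConv f g t := by
  rw [kernelConv, intervalIntegral.integral_of_le ht0, integral_Ioc_eq_integral_Ioo,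
    ← integral_indicator measurableSet_Ioo, convolution_def]
  congr 1 with τ
  by_cases hτ : τ ∈ Ioo 0 t
  · rw [indicator_of_mem hτ, indicator_of_mem (show τ ∈ Ioc 0 T from ⟨hτ.1, hτ.2.le.trans htT⟩),
      indicator_of_mem (show t - τ ∈ Ioc 0 T from ⟨sub_pos.2 hτ.2, by linarith [hτ.1]⟩)]
    simp [mul_comm]
  · rw [indicator_of_notMem hτ]
    by_cases h1 : 0 < τ
    · have : t - τ ∉ Ioc 0 T := fun h2 => hτ ⟨h1, by linarith [h2.1]⟩
      rw [indicator_of_notMem this]; simp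
    · have : τ ∉ Ioc 0 T := fun h2 => h1 h2.1
      rw [indicator_of_notMem this]; simp

theorem integrableOn_kernelConv (hf : IntegrableOn f (Ioc 0 T)) (hg : IntegrableOn g (Ioc 0 T)) :
    IntegrableOn (kernelConv f g) (Ioc 0 T) := by
  rw [← integrable_indicator_iff measurableSet_Ioc] at hf hg
  have h1 := (hg.integrable_convolution (ContinuousLinearMap.mul ℝ ℝ) hf).integrableOn
    (s := Ioc 0 T)
  refine h1.congr ?_
  filter_upwards [ae_restrict_mem measurableSet_Ioc] with t ht
  exact convolution_indicator_Ioc ht.1.le ht.2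

/-- Existence at the single point `t` is a hypothesis because it is obtained in two ways: almost
everywhere for integrable factors, and everywhere when one inner factor is constant. -/
theorem kernelConv_assoc_of_convolutionExistsAt (ht0 : 0 ≤ t) (htT : t ≤ T)
    (hf : IntegrableOn f (Ioc 0 T))
    (hg : IntegrableOn g (Ioc 0 T)) (hh : IntegrableOn h (Ioc 0 T))
    (hex : ConvolutionExistsAt (fun x => ‖(Ioc 0 T).indicator h x‖)
      ((fun x => ‖(Ioc 0 T).indicator g x‖) ⋆[ContinuousLinearMap.mul ℝ ℝ]
        fun x => ‖(Ioc 0 T).indicator f x‖) t (ContinuousLinearMap.mul ℝ ℝ)) :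
    kernelConv f (kernelConv g h) t = kernelConv (kernelConv f g) h t := by
  rw [← integrable_indicator_iff measurableSet_Ioc] at hf hg hh
  have key := convolution_assoc (ContinuousLinearMap.mul ℝ ℝ) (ContinuousLinearMap.mul ℝ ℝ)
    (ContinuousLinearMap.mul ℝ ℝ) (ContinuousLinearMap.mul ℝ ℝ) (fun x y z => mul_assoc x y z)
    hh.aestronglyMeasurable hg.aestronglyMeasurable hf.aestronglyMeasurable
    (hh.ae_convolution_exists _ hg) (hg.norm.ae_convolution_exists _ hf.norm) hex
  have hind : ∀ {a b : ℝ → ℝ} {s : ℝ}, s ≤ T →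
      (Ioc 0 T).indicator (kernelConv a b) s
        = ((Ioc 0 T).indicator b ⋆[ContinuousLinearMap.mul ℝ ℝ] (Ioc 0 T).indicator a) s := by
    intro a b s hs
    by_cases hs0 : 0 < s
    · rw [indicator_of_mem (show s ∈ Ioc 0 T from ⟨hs0, hs⟩),
        convolution_indicator_Ioc hs0.le hs]
    · rw [indicator_of_notMem (fun h => hs0 h.1), convolution_def, eq_comm]
      refine integral_eq_zero_of_ae (Eventually.of_forall fun τ => ?_)
      by_cases h1 : 0 < τ
      · have : s - τ ∉ Ioc 0 T := fun h2 => hs0 (by linarith [h2.1])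
        simp [indicator_of_notMem this]
      · have : τ ∉ Ioc 0 T := fun h2 => h1 h2.1
        simp [indicator_of_notMem this]
  rw [← convolution_indicator_Ioc ht0 htT, ← convolution_indicator_Ioc ht0 htT]
  calc _ = (((Ioc 0 T).indicator h ⋆[ContinuousLinearMap.mul ℝ ℝ] (Ioc 0 T).indicator g)
          ⋆[ContinuousLinearMap.mul ℝ ℝ] (Ioc 0 T).indicator f) t := by
        simp only [convolution_def]
        refine integral_congr_ae (Eventually.of_forall fun τ => ?_)
        simp only [ContinuousLinearMap.mul_apply']
        by_cases hτ : τ ≤ T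
        · rw [hind hτ, convolution_def]; rfl
        · have : t - τ ∉ Ioc 0 T := fun h2 => hτ (by linarith [h2.1])
          rw [indicator_of_notMem this, mul_zero, mul_zero]
    _ = _ := key
    _ = _ := by
        simp only [convolution_def]
        refine integral_congr_ae (Eventually.of_forall fun τ => ?_)
        simp only [ContinuousLinearMap.mul_apply']
        by_cases hτ : 0 < τ
        · rw [hind (by linarith : t - τ ≤ T), convolution_def]; rfl
        · have : τ ∉ Ioc 0 T := fun h2 => hτ h2.1
          rw [indicator_of_notMem this, zero_mul, zero_mul]

end Truncation

/-- Integrability on bounded subintervals of `(0, ∞)`, up to the endpoint `0`. -/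
def LocallyIntegrableFromZero (f : ℝ → ℝ) : Prop :=
  ∀ T : ℝ, IntegrableOn f (Ioc 0 T)

section Associativity

variable {f g h : ℝ → ℝ}

theorem LocallyIntegrableFromZero.kernelConv (hf : LocallyIntegrableFromZero f)
    (hg : LocallyIntegrableFromZero g) : LocallyIntegrableFromZero (kernelConv f g) :=
  fun T => integrableOn_kernelConv (hf T) (hg T)

theorem LocallyIntegrableFromZero.intervalIntegrable (hf : LocallyIntegrableFromZero f) {T : ℝ}
    (hT : 0 ≤ T) : IntervalIntegrable f volume 0 T :=
  (intervalIntegrable_iff_integrableOn_Ioc_of_le hT).2 (hf T)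

theorem locallyIntegrableFromZero_const (c : ℝ) : LocallyIntegrableFromZero fun _ => c :=
  fun T => integrableOn_const (by simp)

theorem ae_kernelConv_assoc (hf : LocallyIntegrableFromZero f) (hg : LocallyIntegrableFromZero g)
    (hh : LocallyIntegrableFromZero h) :
    ∀ᵐ t ∂volume.restrict (Ioi (0 : ℝ)),
      kernelConv f (kernelConv g h) t = kernelConv (kernelConv f g) h t := by
  have h1 : ∀ n : ℕ, ∀ᵐ t : ℝ, t ∈ Ioc (0 : ℝ) n →
      kernelConv f (kernelConv g h) t = kernelConv (kernelConv f g) h t := fun n => by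
    have hf' := (integrable_indicator_iff measurableSet_Ioc).2 (hf n)
    have hg' := (integrable_indicator_iff measurableSet_Ioc).2 (hg n)
    have hh' := (integrable_indicator_iff measurableSet_Ioc).2 (hh n)
    filter_upwards [hh'.norm.ae_convolution_exists (ContinuousLinearMap.mul ℝ ℝ)
      (hg'.norm.integrable_convolution (ContinuousLinearMap.mul ℝ ℝ) hf'.norm)] with t hex ht
    exact kernelConv_assoc_of_convolutionExistsAt ht.1.le ht.2 (hf n) (hg n) (hh n) hex
  rw [ae_restrict_iff' measurableSet_Ioi]
  filter_upwards [ae_all_iff.2 h1] with t ht ht0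
  obtain ⟨n, hn⟩ := exists_nat_ge t
  exact ht n ⟨ht0, hn⟩

theorem kernelConv_integral (hf : LocallyIntegrableFromZero f) (hg : LocallyIntegrableFromZero g)
    {t : ℝ} (ht : 0 ≤ t) :
    kernelConv f (fun x => ∫ s in (0 : ℝ)..x, g s) t = ∫ s in (0 : ℝ)..t, kernelConv f g s := by
  have h1 := (locallyIntegrableFromZero_const 1)
  have hf' := (integrable_indicator_iff measurableSet_Ioc).2 (hf t)
  have hg' := (integrable_indicator_iff measurableSet_Ioc).2 (hg t)
  have h1' := (integrable_indicator_iff measurableSet_Ioc).2 (h1 t)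
  -- Associativity with the constant 1 as a factor: the inner convolution is bounded, so the
  -- identity holds at every `t`.
  have key := kernelConv_assoc_of_convolutionExistsAt ht le_rfl (h1 t) (hg t) (hf t) (by
    have hbd : ∀ x, ‖((fun x => ‖(Ioc 0 t).indicator g x‖) ⋆[ContinuousLinearMap.mul ℝ ℝ]
        fun x => ‖(Ioc 0 t).indicator (fun _ => (1 : ℝ)) x‖) x‖
          ≤ ∫ x, ‖(Ioc 0 t).indicator g x‖ := fun x => by
      rw [convolution_def]
      refine norm_integral_le_of_norm_le hg'.norm (Eventually.of_forall fun s => ?_)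
      simp only [ContinuousLinearMap.mul_apply', norm_mul, norm_norm]
      refine mul_le_of_le_one_right (norm_nonneg _) ?_
      exact (norm_indicator_le_norm_self _ _).trans (by simp)
    have hm := (hg'.norm.integrable_convolution (ContinuousLinearMap.mul ℝ ℝ) h1'.norm).aestronglyMeasurable
    refine (hf'.norm.mul_const (∫ x, ‖(Ioc 0 t).indicator g x‖)).mono'
      (hf'.norm.aestronglyMeasurable.convolution_integrand_snd _ hm t)
      (Eventually.of_forall fun s => ?_)
    simp only [ContinuousLinearMap.mul_apply', norm_mul, norm_norm]
    gcongr
    exact hbd _)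
  have e1 : (fun x => ∫ s in (0 : ℝ)..x, g s) = kernelConv (fun _ => 1) g :=
    funext fun x => (kernelConv_one g x).symm
  rw [kernelConv_comm, e1, ← key, kernelConv_one]
  exact intervalIntegral.integral_congr fun s _ => kernelConv_comm _ _ _

end Associativity

end Convolution

theorem locallyIntegrableFromZero_of_exp {f : ℝ → ℝ} {p : ℝ}
    (hf : IntegrableOn (fun t => Real.exp (-(p * t)) * f t) (Ioi 0)) :
    LocallyIntegrableFromZero f := fun T => by
  have h1 : IntegrableOn (fun t => Real.exp (p * t) * (Real.exp (-(p * t)) * f t)) (Ioc 0 T) := by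
    refine (hf.mono_set Ioc_subset_Ioi_self).bdd_mul (c := Real.exp (|p| * |T|))
      (Continuous.aestronglyMeasurable (by fun_prop)) ?_
    filter_upwards [ae_restrict_mem measurableSet_Ioc] with t ht
    rw [Real.norm_of_nonneg (Real.exp_pos _).le, Real.exp_le_exp]
    calc p * t ≤ |p * t| := le_abs_self _
      _ = |p| * |t| := abs_mul _ _
      _ ≤ |p| * |T| := by
        gcongr ?_ * ?_
        rw [abs_of_pos ht.1]; exact ht.2.trans (le_abs_self _)
  refine h1.congr (Eventually.of_forall fun t => ?_)
  simp only [← mul_assoc, ← Real.exp_add]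
  simp

/-! ### Reduction to a Volterra equation; uniqueness -/

section Volterra

variable {k y u : ℝ → ℝ} {lam : ℝ}

theorem LocallyIntegrableFromZero.continuousOn_primitive (hy : LocallyIntegrableFromZero y)
    (T : ℝ) : ContinuousOn (fun x => ∫ s in (0 : ℝ)..x, y s) (Icc 0 T) := by
  rcases le_or_gt 0 T with hT | hT
  · have := intervalIntegral.continuousOn_primitive_interval (μ := volume) (a := 0) (b := T)
      (f := y) (by rw [uIcc_of_le hT, integrableOn_Icc_iff_integrableOn_Ioc]; exact hy T)
    rwa [uIcc_of_le hT] at this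
  · simp [Icc_eq_empty_of_lt hT]

/-- `k * (1 + 1 * y) = 1 * (k + k * y)`. Differentiating and subtracting `k(t) u(0)` leaves `k * y`.
-/
theorem kernelConv_primitive (hk : LocallyIntegrableFromZero k) (hy : LocallyIntegrableFromZero y)
    (hu : ∀ t, 0 ≤ t → u t = 1 + ∫ s in (0 : ℝ)..t, y s) {t : ℝ} (ht : 0 ≤ t) :
    kernelConv k u t = ∫ s in (0 : ℝ)..t, (k s + kernelConv k y s) := by
  have hkt : IntervalIntegrable (fun τ => k (t - τ)) volume 0 t := by
    have := ((hk.intervalIntegrable ht).comp_sub_left t).symm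
    simpa using this
  have hY : ContinuousOn (fun x => ∫ s in (0 : ℝ)..x, y s) (uIcc 0 t) := by
    rw [uIcc_of_le ht]; exact hy.continuousOn_primitive t
  calc kernelConv k u t
      = ∫ τ in (0 : ℝ)..t, (k (t - τ) + k (t - τ) * ∫ s in (0 : ℝ)..τ, y s) := by
        refine intervalIntegral.integral_congr fun τ hτ => ?_
        rw [uIcc_of_le ht] at hτ
        simp only [hu τ hτ.1]; ring
    _ = (∫ τ in (0 : ℝ)..t, k (t - τ)) + kernelConv k (fun x => ∫ s in (0 : ℝ)..x, y s) t :=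
        intervalIntegral.integral_add hkt (hkt.mul_continuousOn hY)
    _ = (∫ s in (0 : ℝ)..t, k s) + ∫ s in (0 : ℝ)..t, kernelConv k y s := by
        rw [kernelConv_integral hk hy ht, intervalIntegral.integral_comp_sub_left]
        simp
    _ = _ := (intervalIntegral.integral_add (hk.intervalIntegrable ht)
        ((hk.kernelConv hy).intervalIntegrable ht)).symm

theorem ae_hasDerivAt_kernelConv (hk : LocallyIntegrableFromZero k)
    (hy : LocallyIntegrableFromZero y) (hu : ∀ t, 0 ≤ t → u t = 1 + ∫ s in (0 : ℝ)..t, y s) :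
    ∀ᵐ t ∂volume.restrict (Ioi (0 : ℝ)),
      HasDerivAt (kernelConv k u) (k t + kernelConv k y t) t := by
  have h1 : ∀ n : ℕ, ∀ᵐ t : ℝ, t ∈ uIcc (0 : ℝ) n → ∀ c ∈ uIcc (0 : ℝ) n,
      HasDerivAt (fun x => ∫ s in c..x, (k s + kernelConv k y s)) (k t + kernelConv k y t) t :=
    fun n => IntervalIntegrable.ae_hasDerivAt_integral
      (f := fun s => k s + kernelConv k y s)
      ((hk.intervalIntegrable n.cast_nonneg).add
        ((hk.kernelConv hy).intervalIntegrable n.cast_nonneg))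
  rw [ae_restrict_iff' measurableSet_Ioi]
  filter_upwards [ae_all_iff.2 h1] with t ht (ht0 : 0 < t)
  obtain ⟨n, hn⟩ := exists_nat_ge t
  have h2 := ht n (by rw [uIcc_of_le n.cast_nonneg]; exact ⟨ht0.le, hn⟩) 0 left_mem_uIcc
  refine h2.congr_of_eventuallyEq ?_
  filter_upwards [lt_mem_nhds ht0] with x hx using kernelConv_primitive hk hy hu hx.le

theorem isGrowthSolution_of_kernelConv_eq (hk : LocallyIntegrableFromZero k)
    (hy : LocallyIntegrableFromZero y)
    (h : ∀ᵐ t ∂volume.restrict (Ioi (0 : ℝ)),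
      kernelConv k y t = lam * (1 + ∫ s in (0 : ℝ)..t, y s)) :
    IsGrowthSolution k lam fun t => 1 + ∫ s in (0 : ℝ)..t, y s where
  absCont T hT := by
    have h1 := (hy.intervalIntegrable hT.le).absolutelyContinuousOnInterval_intervalIntegral
      (c := 0) left_mem_uIcc
    exact ((LipschitzWith.const (1 : ℝ)).lipschitzOnWith (s := uIcc 0 T)).absolutelyContinuousOnInterval.add h1
  initial := by simp
  equation := by
    filter_upwards [h, ae_hasDerivAt_kernelConv hk hy (u := fun t => 1 + ∫ s in (0 : ℝ)..t, y s)
      (fun _ _ => rfl)] with t h1 h2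
    refine ⟨h2.differentiableAt, ?_⟩
    rw [genFracDeriv, h2.deriv, ← h1]
    simp

theorem IsGrowthSolution.exists_kernelConv_eq (hk : LocallyIntegrableFromZero k)
    (h : IsGrowthSolution k lam u) :
    LocallyIntegrableFromZero (deriv u) ∧ (∀ t, 0 ≤ t → u t = 1 + ∫ s in (0 : ℝ)..t, deriv u s) ∧
      ∀ᵐ t ∂volume.restrict (Ioi (0 : ℝ)),
        kernelConv k (deriv u) t = lam * (1 + ∫ s in (0 : ℝ)..t, deriv u s) := by
  have hy : LocallyIntegrableFromZero (deriv u) := fun T => by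
    rcases le_or_gt T 0 with hT | hT
    · simp [Ioc_eq_empty_of_le hT]
    · exact (intervalIntegrable_iff_integrableOn_Ioc_of_le hT.le).1
        (h.absCont T hT).intervalIntegrable_deriv
  have hu : ∀ t, 0 ≤ t → u t = 1 + ∫ s in (0 : ℝ)..t, deriv u s := fun t ht => by
    rcases ht.eq_or_lt with rfl | ht
    · simp [h.initial]
    · rw [(h.absCont t ht).integral_deriv_eq_sub, h.initial]; ring
  refine ⟨hy, hu, ?_⟩
  filter_upwards [h.equation, ae_hasDerivAt_kernelConv hk hy hu,
    ae_restrict_mem measurableSet_Ioi] with t h1 h2 (ht : 0 < t)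
  rw [← hu t ht.le, ← h1.2, genFracDeriv, h2.deriv, h.initial]
  ring

theorem kernelConv_comm_fun (f g : ℝ → ℝ) : kernelConv f g = kernelConv g f :=
  funext (kernelConv_comm f g)

/-- Two solutions of `k * y = lam (1 + 1 * y)` have the same primitive. -/
theorem primitive_eq_of_kernelConv_eq {y₁ y₂ : ℝ → ℝ} (hlam : lam ≠ 0)
    (hk : LocallyIntegrableFromZero k)
    (hy₁ : LocallyIntegrableFromZero y₁) (hy₂ : LocallyIntegrableFromZero y₂)
    (h₁ : ∀ᵐ t ∂volume.restrict (Ioi (0 : ℝ)),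
      kernelConv k y₁ t = lam * (1 + ∫ s in (0 : ℝ)..t, y₁ s))
    (h₂ : ∀ᵐ t ∂volume.restrict (Ioi (0 : ℝ)),
      kernelConv k y₂ t = lam * (1 + ∫ s in (0 : ℝ)..t, y₂ s)) {t : ℝ} (ht : 0 ≤ t) :
    ∫ s in (0 : ℝ)..t, y₁ s = ∫ s in (0 : ℝ)..t, y₂ s := by
  have hexp : ∀ {a b : ℝ → ℝ}, LocallyIntegrableFromZero a → LocallyIntegrableFromZero b →
      (∀ᵐ t ∂volume.restrict (Ioi (0 : ℝ)),
        kernelConv k b t = lam * (1 + ∫ s in (0 : ℝ)..t, b s)) →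
      ∀ t, 0 ≤ t → kernelConv a (kernelConv k b) t
        = lam * ((∫ s in (0 : ℝ)..t, a s) + ∫ s in (0 : ℝ)..t, kernelConv a b s) := by
    intro a b ha hb hab t ht
    rw [kernelConv_congr_right hab ht, ← kernelConv_integral ha hb ht, ← kernelConv_one a t,
      kernelConv_comm _ a, kernelConv, kernelConv, kernelConv]
    have hat : IntervalIntegrable (fun τ => a (t - τ)) volume 0 t := by
      have := ((ha.intervalIntegrable ht).comp_sub_left t).symm
      simpa using this
    have hB : ContinuousOn (fun x => ∫ s in (0 : ℝ)..x, b s) (uIcc 0 t) := by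
      rw [uIcc_of_le ht]; exact hb.continuousOn_primitive t
    rw [← intervalIntegral.integral_add (hat.mul_const 1) (hat.mul_continuousOn hB),
      ← intervalIntegral.integral_const_mul]
    refine intervalIntegral.integral_congr fun τ _ => ?_
    ring
  -- Both `y₁ * (k * y₂)` and `y₂ * (k * y₁)` equal `k * y₁ * y₂`; after inserting the equations the
  -- terms `1 * (y₁ * y₂)` cancel.
  have hae : ∀ᵐ t ∂volume.restrict (Ioi (0 : ℝ)),
      ∫ s in (0 : ℝ)..t, y₁ s = ∫ s in (0 : ℝ)..t, y₂ s := by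
    filter_upwards [ae_kernelConv_assoc hy₁ hy₂ hk, ae_kernelConv_assoc hy₂ hy₁ hk,
      ae_restrict_mem measurableSet_Ioi] with t g1 g2 (ht : 0 < t)
    have e1 := hexp hy₁ hy₂ h₂ t ht.le
    have e2 := hexp hy₂ hy₁ h₁ t ht.le
    rw [kernelConv_comm_fun k, g1, kernelConv_comm_fun y₁ y₂, ← g2, kernelConv_comm_fun y₁ k, e2] at e1
    have := mul_left_cancel₀ hlam e1
    linarith
  rcases ht.eq_or_lt with rfl | ht
  · simp
  · have hc : ∀ {y : ℝ → ℝ}, LocallyIntegrableFromZero y →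
        ContinuousOn (fun x => ∫ s in (0 : ℝ)..x, y s) (Ioi 0) := fun hy x (hx : 0 < x) =>
      ((hy.continuousOn_primitive (x + 1)).continuousAt
        (Icc_mem_nhds hx (by linarith))).continuousWithinAt
    exact Measure.eqOn_open_of_ae_eq hae isOpen_Ioi (hc hy₁) (hc hy₂) ht

end Volterra

/-! ### The solution and its asymptotics -/

theorem mainTheorem1 (k : ℝ → ℝ) (hk : IsAdmissibleKernel k)
    (hint : IntegrableOn (fun s : ℝ => 1 / (s * laplaceExponent k s)) (Ioi 1))
    (lam : ℝ) (hlam : 0 < lam) :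
    ∃ p₀ : ℝ, 0 < p₀ ∧ laplaceExponent k p₀ = lam ∧
      (∀ p : ℝ, 0 < p → laplaceExponent k p = lam → p = p₀) ∧
      DifferentiableAt ℝ (laplaceExponent k) p₀ ∧ 0 < deriv (laplaceExponent k) p₀ ∧
      ∃ u : ℝ → ℝ, IsGrowthSolution k lam u ∧
        (∀ v : ℝ → ℝ, IsGrowthSolution k lam v → EqOn v u (Ici 0)) ∧
        (fun t : ℝ => u t - lam / (deriv (laplaceExponent k) p₀ * p₀) * Real.exp (p₀ * t))
          =o[atTop] (fun t : ℝ => Real.exp (p₀ * t)) := by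
  obtain ⟨σ, h0, hσ, hK⟩ := hk.exists_measure
  obtain ⟨p₀, hp₀, hΦ⟩ := hk.exists_laplaceExponent_eq h0 hσ hK hlam
  have hd := hasDerivAt_laplaceExponent h0 hσ hK hp₀
  have hd0 : 0 < deriv (laplaceExponent k) p₀ := by
    rw [hd.deriv]; exact hk.stieltjesSlope_pos h0 hσ hK hp₀ hp₀
  refine ⟨p₀, hp₀, hΦ, fun p hp hpl => hk.laplaceExponent_injOn h0 hσ hK hp hp₀ (hpl.trans hΦ.symm),
    hd.differentiableAt, hd0, ?_⟩
  obtain ⟨τ, hτ, hτ0, hres⟩ := hk.exists_resolvent_measure hp₀ hΦ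
  -- Both sides are the limit of `z / (Φ(p₀ + z) - lam)` as `z → 0+`.
  have hatom : τ.real {0} = (deriv (laplaceExponent k) p₀)⁻¹ := by
    refine tendsto_nhds_unique (tendsto_mul_integral_div hτ0) ?_
    have h1 := (hd.differentiableAt.hasDerivAt.tendsto_slope_zero_right).inv₀ hd0.ne'
    refine h1.congr' ?_
    filter_upwards [self_mem_nhdsWithin] with z (hz : 0 < z)
    rw [← hres z hz, hΦ, smul_eq_mul, mul_inv, inv_inv]
  -- The candidate for `u'`: the factor `e^{p₀ t}` undoes the shift by `p₀`, so its transform is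
  -- `lam / (Φ(p) - lam)`.
  let v : ℝ → ℝ := fun t => lam * (Real.exp (p₀ * t) * mixedExp τ t)
  have hvE : ∀ p t : ℝ, Real.exp (-(p * t)) * v t
      = lam * (Real.exp (-((p - p₀) * t)) * mixedExp τ t) := fun p t => by
    have : Real.exp (-((p - p₀) * t)) = Real.exp (-(p * t)) * Real.exp (p₀ * t) := by
      rw [← Real.exp_add]; ring_nf
    simp only [v, this]; ring
  have hvi : ∀ p, p₀ < p → IntegrableOn (fun t => Real.exp (-(p * t)) * v t) (Ioi 0) := by
    intro p hp
    simp only [hvE]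
    exact (integrableOn_laplace_mixedExp hτ0 (sub_pos.2 hp)).1.const_mul lam
  have hvL : ∀ p, p₀ < p → laplaceTransform v p = lam * (laplaceExponent k p - lam)⁻¹ := by
    intro p hp
    rw [laplaceTransform]
    simp only [hvE]
    rw [integral_const_mul, (integrableOn_laplace_mixedExp hτ0 (sub_pos.2 hp)).2,
      ← hres _ (sub_pos.2 hp), add_sub_cancel]
  have hone : ∀ p, 0 < p → IntegrableOn (fun t => Real.exp (-(p * t)) * (1 : ℝ)) (Ioi 0) ∧
      laplaceTransform (fun _ => 1) p = p⁻¹ := fun p hp => by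
    simp only [laplaceTransform, mul_one, ← neg_mul]
    refine ⟨integrableOn_exp_mul_Ioi (neg_lt_zero.2 hp) 0, ?_⟩
    rw [integral_exp_mul_Ioi (neg_lt_zero.2 hp), mul_zero, Real.exp_zero, neg_div_neg_eq, one_div]
  have hvloc : LocallyIntegrableFromZero v :=
    locallyIntegrableFromZero_of_exp (hvi (p₀ + 1) (by linarith))
  have hkloc : LocallyIntegrableFromZero k :=
    locallyIntegrableFromZero_of_exp (hk.integrable 1 one_pos)
  have heq : ∀ᵐ t ∂volume.restrict (Ioi (0 : ℝ)),
      kernelConv k v t = lam * (1 + ∫ s in (0 : ℝ)..t, v s) := by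
    simp only [← kernelConv_one v]
    refine ae_eq_of_laplace_eq (c := p₀)
      (fun p hp => (laplace_kernelConv (hk.integrable p (hp₀.trans hp)) (hvi p hp)).1)
      (fun p hp => ?_) (fun p hp => ?_)
    · have h1 := ((hone p (hp₀.trans hp)).1.add
        (laplace_kernelConv (hone p (hp₀.trans hp)).1 (hvi p hp)).1).const_mul lam
      refine h1.congr (Eventually.of_forall fun t => ?_)
      simp only [Pi.add_apply]; ring
    · have hp0 := hp₀.trans hp
      have h1 := laplace_kernelConv (hone p hp0).1 (hvi p hp)
      have h2 : laplaceTransform (fun t => lam * (1 + kernelConv (fun _ => 1) v t)) p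
          = lam * (p⁻¹ + p⁻¹ * laplaceTransform v p) := by
        rw [← (hone p hp0).2, ← h1.2, laplaceTransform, laplaceTransform, laplaceTransform,
          ← integral_add (hone p hp0).1 h1.1, ← integral_const_mul]
        refine integral_congr_ae (Eventually.of_forall fun t => ?_)
        simp only; ring
      rw [h2, (laplace_kernelConv (hk.integrable p hp0) (hvi p hp)).2, hvL p hp]
      have hpos : laplaceExponent k p - lam ≠ 0 := by
        rw [← hΦ, laplaceExponent_sub h0 hσ hK hp0 hp₀]
        exact (mul_pos (sub_pos.2 hp) (hk.stieltjesSlope_pos h0 hσ hK hp0 hp₀)).ne'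
      have hΦp : laplaceTransform k p = laplaceExponent k p / p := by
        rw [laplaceExponent, mul_div_cancel_left₀ _ hp0.ne']
      rw [hΦp]
      field_simp
      ring
  refine ⟨fun t => 1 + ∫ s in (0 : ℝ)..t, v s, isGrowthSolution_of_kernelConv_eq hkloc hvloc heq,
    fun w hw t (ht : 0 ≤ t) => ?_, ?_⟩
  · obtain ⟨hy, hw', hweq⟩ := hw.exists_kernelConv_eq hkloc
    rw [hw' t ht, primitive_eq_of_kernelConv_eq hlam.ne' hkloc hy hvloc hweq heq ht]
  · set c := τ.real {0} with hc
    have hsplit : ∀ x, Real.exp (p₀ * x) * (mixedExp τ x - c)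
        = lam⁻¹ * v x - c * Real.exp (p₀ * x) := fun x => by
      simp only [v]; field_simp
    have hexpi : ∀ T, IntervalIntegrable (fun x => c * Real.exp (p₀ * x)) volume 0 T := fun T =>
      Continuous.intervalIntegrable (by fun_prop) _ _
    have hlim : Tendsto (fun t => mixedExp τ t - c) atTop (𝓝 0) := by
      rw [← sub_self c]
      exact (tendsto_mixedExp hτ0).sub_const c
    have ho := isLittleO_integral_exp_mul hp₀ (fun T hT => by
      simp only [hsplit]
      exact ((hvloc.intervalIntegrable hT.le).const_mul _).sub (hexpi T)) hlim
    -- The constant collects the initial value 1 and the lower endpoint of `lam c ∫₀^t e^{p₀ x} dx`.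
    have hconst : (fun _ : ℝ => 1 - lam * c / p₀) =o[atTop] fun t : ℝ => Real.exp (p₀ * t) :=
      isLittleO_const_left.2 (Or.inr (tendsto_norm_atTop_atTop.comp
        (Real.tendsto_exp_atTop.comp (tendsto_id.const_mul_atTop hp₀))))
    refine (hconst.add (ho.const_mul_left lam)).congr' ?_ EventuallyEq.rfl
    filter_upwards [eventually_ge_atTop 0] with t ht
    have hder : ∀ x ∈ uIcc 0 t, HasDerivAt (fun x => c / p₀ * Real.exp (p₀ * x))
        (c * Real.exp (p₀ * x)) x := fun x _ => by
      have := (((hasDerivAt_id x).const_mul p₀).exp).const_mul (c / p₀)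
      convert! this using 1
      simp; field_simp
    simp only [hsplit]
    rw [intervalIntegral.integral_sub ((hvloc.intervalIntegrable ht).const_mul _) (hexpi t),
      intervalIntegral.integral_const_mul,
      intervalIntegral.integral_eq_sub_of_hasDerivAt hder (hexpi t)]
    have hdc : lam / (deriv (laplaceExponent k) p₀ * p₀) = lam * c / p₀ := by
      rw [hatom]; field_simp
    rw [hdc, mul_zero, Real.exp_zero]
    field_simp
    ring
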